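/- Let $(Y_k)_{k\ge 1}$ be i.i.d. real random variables, and let $\ell$ be slowly varying at $\infty$, i.e. $\ell$ is positive and measurable on some half-line $[X,\infty)$ and $\ell(rx)/\ell(x)\to 1$ as $x\to\infty$ for every $r>0$. Assume that $P(Y_1^2>x)\sim \ell(x)x^{-1}$ as $x\to\infty$ and that $E Y_1^2=\infty$. Put $\delta_{1,n}=Y_1/V_n$ with $V_n=\big(\sum_{k=1}^n Y_k^2\big)^{1/2}$ (and $\delta_{1,n}=0$ where $V_n=0$), and let $L(x)=\int_c^x \frac{\ell(t)}{t}\,dt$, where $c\ge 0$ is any lower limit such that $\ell(t)/t$ is integrable over $[c,x]$ for all $x\ge c$; such $c$ exist. Then there is a sequence $(a_n)$ with $a_n\to\infty$ and $a_n\sim nL(a_n)$ as $n\to\infty$, and for every such sequence and every $\gamma>1$, $$ nE|\delta_{1,n}|^{2\gamma}\;\sim\;\frac{1}{\gamma-1}\,\frac{\ell(a_n)}{L(a_n)}\qquad (n\to\infty). $$ -/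

import Mathlib

open MeasureTheory ProbabilityTheory Filter Topology Asymptotics

noncomputable section

/-- `ℓ` is slowly varying at infinity: on some half-line `[X, ∞)` it is positive and measurable,
and `ℓ (r x) / ℓ x → 1` as `x → ∞` for every `r > 0`. -/
def SlowlyVarying (ℓ : ℝ → ℝ) : Prop :=
  (∃ X : ℝ, (∀ x, X ≤ x → 0 < ℓ x) ∧ Measurable fun x : Set.Ici X => ℓ x) ∧
    ∀ r : ℝ, 0 < r → Tendsto (fun x => ℓ (r * x) / ℓ x) atTop (𝓝 1)

/-- `c ≥ 0` is an admissible lower limit for the integral `∫^x ℓ(t)/t dt`: the integrand is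
integrable over `[c, x]` for every `x ≥ c`. -/
def AdmissibleLowerLimit (ℓ : ℝ → ℝ) (c : ℝ) : Prop :=
  0 ≤ c ∧ ∀ x, c ≤ x → IntervalIntegrable (fun t => ℓ t / t) volume c x

/-- `L(x) = ∫_c^x ℓ(t)/t dt`. -/
def tailIntegral (ℓ : ℝ → ℝ) (c x : ℝ) : ℝ :=
  ∫ t in c..x, ℓ t / t

/-- `a_n → ∞` and `a_n ∼ n L(a_n)`. -/
def IsNormingSequence (L : ℝ → ℝ) (a : ℕ → ℝ) : Prop :=
  Tendsto a atTop atTop ∧ a ~[atTop] fun n => (n : ℝ) * L (a n)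

/-- `V_n = (∑_{k=1}^n Y_k²)^{1/2}`. The sequence is indexed from `0`, so `Y_k` is
`Y (k - 1)`. -/
def selfNorm {Ω : Type*} (Y : ℕ → Ω → ℝ) (n : ℕ) (ω : Ω) : ℝ :=
  √(∑ k ∈ Finset.range n, Y k ω ^ 2)

/-- `δ_{k+1,n} = Y_{k+1} / V_n` (equal to `0` where `V_n = 0`). -/
def selfNormRatio {Ω : Type*} (Y : ℕ → Ω → ℝ) (k n : ℕ) (ω : Ω) : ℝ :=
  Y k ω / selfNorm Y n ω

end

/-!
Write `X k = Y k ^ 2`, `S` for the sum of the first `n` of these and `T` for the tail function of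
`X 0`. The Gamma integral `Γ(γ) s ^ (-γ) = ∫ t ^ (γ - 1) e ^ (-t s) dt` and independence turn
`Γ(γ) E[(X 0 / S) ^ γ]` into
`∫ t⁻¹ E[(t X 0) ^ γ e ^ (-t X 0)] (E e ^ (-t X 0)) ^ (n - 1) dt`. Since `T` is regularly varying
with index `-1`, as `z → ∞` the expectation at `t = 1 / z` is asymptotic to `Γ(γ - 1) T(z)`, and
`1 - E e ^ (-X 0 / z)` to the mean of `T` over `[0, z]`. The norming `a_n ∼ n L(a_n)` says that `n`
times the mean of `T` over `[0, a_n]` tends to `1`, so after substituting `t = u / a_n` the power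
tends to `e ^ (-u)` and the integral, which Potter's bounds dominate, is asymptotic to
`Γ(γ - 1) T(a_n)`. Finally `Γ(γ - 1) / Γ(γ) = 1 / (γ - 1)` and `n T(a_n) ∼ ℓ(a_n) / L(a_n)`.
-/

/-- `f` is regularly varying at infinity with index `ρ`. Only the limits of the ratios are
recorded; positivity and measurability appear as separate hypotheses where they matter. -/
def RegularlyVarying (f : ℝ → ℝ) (ρ : ℝ) : Prop :=
  ∀ r : ℝ, 0 < r → Tendsto (fun x => f (r * x) / f x) atTop (𝓝 (r ^ ρ))

lemma SlowlyVarying.regularlyVarying {ℓ : ℝ → ℝ} (hℓ : SlowlyVarying ℓ) :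
    RegularlyVarying ℓ 0 := fun r hr => by
  simpa only [Real.rpow_zero] using hℓ.2 r hr

lemma apply_le_div_mul_apply_max {f : ℝ → ℝ} (hpos : ∀ x, 0 < f x) (hanti : Antitone f) {x₀ w : ℝ}
    (hw : 0 ≤ w) (hx₀ : 0 ≤ x₀) : f w ≤ f 0 / f x₀ * f (max w x₀) := by
  rcases le_total w x₀ with hwx | hwx
  · rw [max_eq_right hwx, div_mul_cancel₀ _ (hpos x₀).ne']
    exact hanti hw
  · rw [max_eq_left hwx]
    exact le_mul_of_one_le_left (hpos w).le ((one_le_div (hpos x₀)).2 (hanti hx₀))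

lemma apply_two_pow_mul_le {f : ℝ → ℝ} {c x₀ : ℝ} (hc : 0 ≤ c) (hx₀ : 0 ≤ x₀)
    (hf : ∀ x, x₀ ≤ x → f (2 * x) ≤ c * f x) (n : ℕ) {x : ℝ} (hx : x₀ ≤ x) :
    f (2 ^ n * x) ≤ c ^ n * f x := by
  induction n with
  | zero => simp only [pow_zero, one_mul, le_refl]
  | succ n ih =>
    have hge : x₀ ≤ 2 ^ n * x :=
      hx.trans (le_mul_of_one_le_left (hx₀.trans hx) (one_le_pow₀ one_le_two))
    calc f (2 ^ (n + 1) * x) = f (2 * (2 ^ n * x)) := by ring_nf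
      _ ≤ c * f (2 ^ n * x) := hf _ hge
      _ ≤ c * (c ^ n * f x) := by gcongr
      _ = c ^ (n + 1) * f x := by ring

namespace RegularlyVarying

variable {f g : ℝ → ℝ} {ρ σ : ℝ}

lemma mul (hf : RegularlyVarying f ρ) (hg : RegularlyVarying g σ) :
    RegularlyVarying (fun x => f x * g x) (ρ + σ) := fun r hr => by
  simpa only [mul_div_mul_comm, Real.rpow_add hr] using (hf r hr).mul (hg r hr)

lemma congr (hg : RegularlyVarying g ρ) (hfg : f ~[atTop] g) : RegularlyVarying f ρ :=
  fun r hr => ((hfg.comp_tendsto (tendsto_id.const_mul_atTop hr)).div hfg).symm.tendsto_nhds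
    (hg r hr)

protected lemma inv : RegularlyVarying (fun x => x⁻¹) (-1) := fun r hr => by
  refine tendsto_const_nhds.congr' ?_
  filter_upwards [eventually_ne_atTop 0] with x hx
  rw [Real.rpow_neg_one]
  field_simp

protected lemma pos (hf : RegularlyVarying f ρ) (hanti : Antitone f) (hnonneg : ∀ x, 0 ≤ f x)
    (x : ℝ) : 0 < f x := by
  refine (hnonneg x).lt_of_ne' fun hx => ?_
  -- Past a zero of `f` all ratios are `0`, by the convention `y / 0 = 0`, rather than close to `1`.
  have hzero : ∀ᶠ y in atTop, f (1 * y) / f y = 0 := by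
    filter_upwards [eventually_ge_atTop x] with y hy
    rw [(hanti hy |>.trans hx.le).antisymm (hnonneg y), div_zero]
  have hlim := (hf 1 one_pos).congr' hzero
  rw [Real.one_rpow] at hlim
  exact zero_ne_one (tendsto_nhds_unique tendsto_const_nhds hlim)

lemma eventually_apply_two_mul_le (hf : RegularlyVarying f ρ) (hpos : ∀ x, 0 < f x)
    (hρ : ρ < σ) : ∀ᶠ x in atTop, f (2 * x) ≤ 2 ^ σ * f x := by
  filter_upwards [(hf 2 two_pos).eventually_lt_const
    (Real.rpow_lt_rpow_of_exponent_lt one_lt_two hρ)] with x hx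
  exact ((div_lt_iff₀ (hpos x)).1 hx).le

lemma eventually_le_apply_two_mul (hf : RegularlyVarying f ρ) (hpos : ∀ x, 0 < f x)
    (hρ : σ < ρ) : ∀ᶠ x in atTop, 2 ^ σ * f x ≤ f (2 * x) := by
  filter_upwards [(hf 2 two_pos).eventually_const_lt
    (Real.rpow_lt_rpow_of_exponent_lt one_lt_two hρ)] with x hx
  exact ((lt_div_iff₀ (hpos x)).1 hx).le

/-- Potter's upper bound. The factor `2` is the loss in the dyadic iteration. -/
lemma exists_le_rpow_mul (hf : RegularlyVarying f ρ) (hpos : ∀ x, 0 < f x) (hanti : Antitone f)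
    (hρ : ρ < σ) (hσ : σ ≤ 0) :
    ∃ x₀ > 0, ∀ y z, x₀ ≤ y → y ≤ z → f z ≤ (z / (2 * y)) ^ σ * f y := by
  obtain ⟨x₀, h⟩ := ((eventually_gt_atTop 0).and
    (hf.eventually_apply_two_mul_le hpos hρ)).exists_forall_of_atTop
  have hx₀ : 0 < x₀ := (h x₀ le_rfl).1
  refine ⟨x₀, hx₀, fun y z hy hyz => ?_⟩
  have hy0 : 0 < y := hx₀.trans_le hy
  obtain ⟨n, hn, hn'⟩ := exists_nat_pow_near ((one_le_div hy0).2 hyz) one_lt_two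
  calc f z ≤ f (2 ^ n * y) := hanti ((le_div_iff₀ hy0).1 hn)
    _ ≤ (2 ^ σ) ^ n * f y :=
      apply_two_pow_mul_le (by positivity) hx₀.le (fun x hx => (h x hx).2) n hy
    _ = (2 ^ n : ℝ) ^ σ * f y := by rw [Real.rpow_pow_comm zero_le_two]
    _ ≤ (z / (2 * y)) ^ σ * f y := by
      have hz : z / (2 * y) ≤ 2 ^ n := by
        rw [mul_comm 2 y, ← div_div, div_le_iff₀ two_pos, ← pow_succ]
        exact hn'.le
      have := Real.rpow_le_rpow_of_nonpos (div_pos (hy0.trans_le hyz) (by positivity)) hz hσ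
      have := (hpos y).le
      gcongr

lemma exists_rpow_mul_le (hf : RegularlyVarying f ρ) (hpos : ∀ x, 0 < f x) (hanti : Antitone f)
    (hρ : σ < ρ) (hσ : σ ≤ 0) :
    ∃ x₀ > 0, ∀ y z, x₀ ≤ y → y ≤ z → (2 * z / y) ^ σ * f y ≤ f z := by
  obtain ⟨x₀, h⟩ := ((eventually_gt_atTop 0).and
    (hf.eventually_le_apply_two_mul hpos hρ)).exists_forall_of_atTop
  have hx₀ : 0 < x₀ := (h x₀ le_rfl).1
  refine ⟨x₀, hx₀, fun y z hy hyz => ?_⟩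
  have hy0 : 0 < y := hx₀.trans_le hy
  obtain ⟨n, hn, hn'⟩ := exists_nat_pow_near ((one_le_div hy0).2 hyz) one_lt_two
  have hdyadic : (2 ^ σ) ^ (n + 1) * f y ≤ f (2 ^ (n + 1) * y) := by
    have := apply_two_pow_mul_le (f := fun x => -f x) (by positivity : (0 : ℝ) ≤ 2 ^ σ) hx₀.le
      (fun x hx => by linarith [(h x hx).2]) (n + 1) hy
    linarith
  calc (2 * z / y) ^ σ * f y ≤ (2 ^ (n + 1) : ℝ) ^ σ * f y := by
        have hz : (2 : ℝ) ^ (n + 1) ≤ 2 * z / y := by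
          rw [pow_succ', mul_div_assoc]
          gcongr
        have := Real.rpow_le_rpow_of_nonpos (by positivity) hz hσ
        have := (hpos y).le
        gcongr
    _ = (2 ^ σ) ^ (n + 1) * f y := by rw [Real.rpow_pow_comm zero_le_two]
    _ ≤ f (2 ^ (n + 1) * y) := hdyadic
    _ ≤ f z := hanti ((div_le_iff₀ hy0).1 hn'.le)

lemma isBigO_rpow (hf : RegularlyVarying f ρ) (hpos : ∀ x, 0 < f x) (hanti : Antitone f)
    (hρ : ρ < σ) (hσ : σ ≤ 0) : f =O[atTop] (· ^ σ) := by
  obtain ⟨x₀, hx₀, h⟩ := hf.exists_le_rpow_mul hpos hanti hρ hσ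
  refine IsBigO.of_bound ((2 * x₀) ^ (-σ) * f x₀) ?_
  filter_upwards [eventually_ge_atTop x₀] with z hz
  have hz0 : 0 < z := hx₀.trans_le hz
  rw [Real.norm_of_nonneg (hpos z).le, Real.norm_of_nonneg (by positivity)]
  refine (h x₀ z le_rfl hz).trans_eq ?_
  rw [Real.div_rpow hz0.le (by positivity), Real.rpow_neg (by positivity)]
  ring

lemma rpow_isBigO (hf : RegularlyVarying f ρ) (hpos : ∀ x, 0 < f x) (hanti : Antitone f)
    (hρ : σ < ρ) (hσ : σ ≤ 0) : (· ^ σ) =O[atTop] f := by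
  obtain ⟨x₀, hx₀, h⟩ := hf.exists_rpow_mul_le hpos hanti hρ hσ
  have hfx₀ := hpos x₀
  refine IsBigO.of_bound ((2 / x₀) ^ (-σ) / f x₀) ?_
  filter_upwards [eventually_ge_atTop x₀] with z hz
  have hz0 : 0 < z := hx₀.trans_le hz
  rw [Real.norm_of_nonneg (hpos z).le, Real.norm_of_nonneg (by positivity)]
  calc z ^ σ = (2 / x₀) ^ (-σ) / f x₀ * ((2 * z / x₀) ^ σ * f x₀) := by
        rw [mul_div_right_comm, Real.mul_rpow (by positivity) hz0.le,
          Real.rpow_neg (by positivity)]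
        field_simp
    _ ≤ _ := by gcongr; exact h x₀ z le_rfl hz

/-- A global form of Potter's bound, uniform in `z` down to `0`. -/
lemma exists_apply_mul_le (hf : RegularlyVarying f ρ) (hpos : ∀ x, 0 < f x) (hanti : Antitone f)
    (hρ : σ < ρ) (hσ : σ ≤ 0) :
    ∃ C > 0, ∀ x z, 0 < x → 0 < z → f (z * x) ≤ C * (1 + x ^ σ) * f z := by
  obtain ⟨x₀, hx₀, h⟩ := hf.exists_rpow_mul_le hpos hanti hρ hσ
  have hf0 := hpos 0
  have hfx₀ := hpos x₀
  have h2 : (1 : ℝ) ≤ 2 ^ (-σ) := Real.one_le_rpow one_le_two (by linarith)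
  have hratio : 1 ≤ f 0 / f x₀ := (one_le_div hfx₀).2 (hanti hx₀.le)
  refine ⟨f 0 / f x₀ * 2 ^ (-σ), by positivity, fun x z hx hz => ?_⟩
  have hfz := hpos z
  rcases le_total 1 x with h1 | h1
  · refine (hanti (le_mul_of_one_le_right hz.le h1)).trans (le_mul_of_one_le_left hfz.le ?_)
    have hxσ : 0 ≤ x ^ σ := by positivity
    exact one_le_mul_of_one_le_of_one_le (one_le_mul_of_one_le_of_one_le hratio h2) (by linarith)
  · have hy : 0 < max (z * x) x₀ := lt_max_of_lt_right hx₀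
    have hle : max (z * x) x₀ ≤ max z x₀ :=
      max_le_max_right _ (mul_le_of_le_one_right hz.le h1)
    have hquot : 2 * max z x₀ / max (z * x) x₀ ≤ 2 / x := by
      rw [div_le_div_iff₀ hy hx, mul_assoc, max_mul_of_nonneg _ _ hx.le]
      gcongr
      exact mul_le_of_le_one_right hx₀.le h1
    have hpotter : (2 / x) ^ σ * f (max (z * x) x₀) ≤ f (max z x₀) := by
      have := Real.rpow_le_rpow_of_nonpos (by positivity) hquot hσ
      have := (hpos (max (z * x) x₀)).le
      calc _ ≤ (2 * max z x₀ / max (z * x) x₀) ^ σ * f (max (z * x) x₀) := by gcongr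
        _ ≤ _ := h _ _ (le_max_right _ _) hle
    rw [← le_div_iff₀' (by positivity)] at hpotter
    calc f (z * x) ≤ f 0 / f x₀ * f (max (z * x) x₀) :=
        apply_le_div_mul_apply_max hpos hanti (by positivity) hx₀.le
      _ ≤ f 0 / f x₀ * (f (max z x₀) / (2 / x) ^ σ) := by gcongr
      _ ≤ f 0 / f x₀ * (f z / (2 / x) ^ σ) := by gcongr; exact hanti (le_max_left _ _)
      _ = f 0 / f x₀ * 2 ^ (-σ) * x ^ σ * f z := by
        rw [Real.div_rpow zero_le_two hx.le, Real.rpow_neg zero_le_two]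
        field_simp
      _ ≤ f 0 / f x₀ * 2 ^ (-σ) * (1 + x ^ σ) * f z := by gcongr; linarith

end RegularlyVarying

/-- The mean of `f` over `[0, z]`, written over the fixed interval `[0, 1]` so that it inherits
antitonicity from `f` and equals `f 0` at `z = 0`. -/
noncomputable def runningMean (f : ℝ → ℝ) (z : ℝ) : ℝ := ∫ x in (0 : ℝ)..1, f (z * x)

lemma intervalIntegrable_comp_mul_left {f : ℝ → ℝ} (hf : Antitone f) (z a b : ℝ) :
    IntervalIntegrable (fun x => f (z * x)) volume a b := by
  rcases le_total 0 z with hz | hz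
  · exact (hf.comp_monotone (monotone_mul_left_of_nonneg hz)).intervalIntegrable
  · exact (hf.comp (antitone_mul_left hz)).intervalIntegrable

section RunningMean

variable {f : ℝ → ℝ} {ρ : ℝ}

lemma mul_runningMean (f : ℝ → ℝ) (z : ℝ) : z * runningMean f z = ∫ t in (0 : ℝ)..z, f t := by
  simp only [runningMean, intervalIntegral.mul_integral_comp_mul_left, mul_zero, mul_one]

lemma antitone_runningMean (hf : Antitone f) : Antitone (runningMean f) := fun y z hyz =>
  intervalIntegral.integral_mono_on zero_le_one (intervalIntegrable_comp_mul_left hf z 0 1)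
    (intervalIntegrable_comp_mul_left hf y 0 1)
    fun _ hx => hf (mul_le_mul_of_nonneg_right hyz hx.1)

lemma runningMean_pos (hf : Antitone f) (hpos : ∀ x, 0 < f x) (z : ℝ) : 0 < runningMean f z :=
  intervalIntegral.intervalIntegral_pos_of_pos (intervalIntegrable_comp_mul_left hf z 0 1)
    (fun _ => hpos _) one_pos

lemma continuousOn_runningMean (hf : Antitone f) : ContinuousOn (runningMean f) (Set.Ioi 0) := by
  have hprim : Continuous fun z => ∫ t in (0 : ℝ)..z, f t :=
    intervalIntegral.continuous_primitive (fun _ _ => hf.intervalIntegrable) 0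
  refine (hprim.continuousOn.div continuousOn_id fun z hz => ne_of_gt hz).congr fun z hz => ?_
  rw [Pi.div_apply, ← mul_runningMean, id_eq, mul_div_cancel_left₀ _ (ne_of_gt hz)]

lemma mul_runningMean_mul (hf : Antitone f) (r z : ℝ) :
    r * runningMean f (r * z) = runningMean f z + ∫ x in (1 : ℝ)..r, f (z * x) := by
  simp only [runningMean]
  rw [intervalIntegral.integral_add_adjacent_intervals (intervalIntegrable_comp_mul_left hf z 0 1)
    (intervalIntegrable_comp_mul_left hf z 1 r)]
  simpa only [mul_zero, mul_one, mul_assoc, mul_left_comm z] using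
    intervalIntegral.mul_integral_comp_mul_left r (f := fun x => f (z * x)) (a := 0) (b := 1)

namespace RegularlyVarying

lemma tendsto_intervalIntegral (hf : RegularlyVarying f ρ) (hanti : Antitone f)
    (hpos : ∀ x, 0 < f x) {a b : ℝ} (ha : 0 < a) (hb : 0 < b) :
    Tendsto (fun z => ∫ x in a..b, f (z * x) / f z) atTop (𝓝 (∫ x in a..b, x ^ ρ)) := by
  have hm : 0 < min a b := lt_min ha hb
  refine intervalIntegral.tendsto_integral_filter_of_dominated_convergence
    (fun _ => min a b ^ ρ + 1) (.of_forall fun z => ?_) ?_ intervalIntegrable_const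
    (.of_forall fun x hx => ?_)
  · exact (IntervalIntegrable.div_const
      (intervalIntegrable_comp_mul_left hanti z a b) _).def'.aestronglyMeasurable
  · filter_upwards [(hf _ hm).eventually_lt_const (lt_add_one _), eventually_ge_atTop 0]
      with z hz hz0
    refine .of_forall fun x hx => ?_
    rw [Real.norm_of_nonneg (div_pos (hpos _) (hpos z)).le]
    refine le_trans ?_ hz.le
    rw [mul_comm (min a b)]
    have := hpos z
    gcongr
    exact hanti (by gcongr; exact hx.1.le)
  · simpa only [mul_comm x] using hf x (hm.trans hx.1)

/-- This is the divergence of `∫ x in δ..1, x⁻¹` as `δ → 0`. -/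
lemma isLittleO_runningMean (hf : RegularlyVarying f (-1)) (hanti : Antitone f)
    (hpos : ∀ x, 0 < f x) : f =o[atTop] runningMean f := by
  refine IsLittleO.of_bound fun ε hε => ?_
  set δ := Real.exp (-(2 * ε⁻¹))
  have hδ : 0 < δ := Real.exp_pos _
  have hδ1 : δ ≤ 1 := Real.exp_le_one_iff.2 (by have := inv_pos.2 hε; linarith)
  have hlog : ∫ x in δ..1, x ^ (-1 : ℝ) = 2 * ε⁻¹ := by
    simp only [Real.rpow_neg_one, integral_inv_of_pos hδ one_pos, one_div, Real.log_inv,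
      δ, Real.log_exp, neg_neg]
  have hlim := hf.tendsto_intervalIntegral hanti hpos hδ one_pos
  filter_upwards [hlim.eventually_const_lt (hlog.symm ▸ by have := inv_pos.2 hε; linarith :
    ε⁻¹ < ∫ x in δ..1, x ^ (-1 : ℝ))] with z hz
  rw [Real.norm_of_nonneg (hpos z).le, Real.norm_of_nonneg (runningMean_pos hanti hpos z).le,
    ← inv_mul_le_iff₀ hε]
  calc ε⁻¹ * f z ≤ ∫ x in δ..1, f (z * x) := by
        rw [intervalIntegral.integral_div, lt_div_iff₀ (hpos z)] at hz
        exact hz.le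
    _ ≤ runningMean f z :=
      intervalIntegral.integral_mono_interval hδ.le hδ1 le_rfl (.of_forall fun _ => (hpos _).le)
        (intervalIntegrable_comp_mul_left hanti z 0 1)

protected lemma runningMean (hf : RegularlyVarying f (-1)) (hanti : Antitone f)
    (hpos : ∀ x, 0 < f x) : RegularlyVarying (runningMean f) (-1) := fun r hr => by
  have hincr := (hf.tendsto_intervalIntegral hanti hpos one_pos hr).mul
    (hf.isLittleO_runningMean hanti hpos).tendsto_div_nhds_zero
  rw [mul_zero] at hincr
  have hlim := (hincr.const_add 1).const_mul r⁻¹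
  rw [add_zero, mul_one, ← Real.rpow_neg_one] at hlim
  refine hlim.congr fun z => ?_
  have hz := runningMean_pos hanti hpos z
  have hfz := hpos z
  have hsplit := mul_runningMean_mul hanti r z
  rw [intervalIntegral.integral_div, div_mul_div_cancel₀ hfz.ne', Real.rpow_neg_one,
    inv_mul_eq_div, div_eq_div_iff hr.ne' hz.ne']
  rw [mul_comm _ r, hsplit, add_mul, one_mul, div_mul_cancel₀ _ hz.ne']

lemma tendsto_runningMean_zero (hf : RegularlyVarying f (-1)) (hanti : Antitone f)
    (hpos : ∀ x, 0 < f x) : Tendsto (runningMean f) atTop (𝓝 0) :=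
  ((hf.runningMean hanti hpos).isBigO_rpow (runningMean_pos hanti hpos)
    (antitone_runningMean hanti) (σ := -(1 / 2)) (by norm_num) (by norm_num)).trans_tendsto
    (tendsto_rpow_neg_atTop (by norm_num))

end RegularlyVarying

end RunningMean

lemma exists_tendsto_natCast_mul_one {f : ℝ → ℝ} (hanti : Antitone f) (hpos : ∀ x, 0 < f x)
    (hcont : ContinuousOn f (Set.Ioi 0)) (hlim : Tendsto f atTop (𝓝 0)) :
    ∃ a : ℕ → ℝ, Tendsto a atTop atTop ∧ Tendsto (fun n : ℕ => n * f (a n)) atTop (𝓝 1) := by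
  have hinv := tendsto_inv_atTop_nhds_zero_nat (𝕜 := ℝ)
  have hsol : ∀ᶠ n : ℕ in atTop, ∃ x, f x = (n : ℝ)⁻¹ := by
    filter_upwards [hinv.eventually_lt_const (hpos 1), eventually_gt_atTop 0] with n hn hn0
    obtain ⟨b, hfb, hb⟩ := ((hlim.eventually_lt_const (by positivity : (0 : ℝ) < (n : ℝ)⁻¹)).and
      (eventually_ge_atTop 1)).exists
    have hsub : Set.Icc 1 b ⊆ Set.Ioi 0 := fun x hx => one_pos.trans_le hx.1
    obtain ⟨x, -, hx⟩ := intermediate_value_Icc' hb (hcont.mono hsub) ⟨hfb.le, hn.le⟩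
    exact ⟨x, hx⟩
  obtain ⟨a, ha⟩ := hsol.choice
  refine ⟨a, tendsto_atTop.2 fun b => ?_, tendsto_const_nhds.congr' ?_⟩
  · filter_upwards [ha, hinv.eventually_lt_const (hpos b)] with n hn hb
    exact (hanti.reflect_lt (hn ▸ hb)).le
  · filter_upwards [ha, eventually_ne_atTop 0] with n hn hn0
    rw [hn, mul_inv_cancel₀ (by exact_mod_cast hn0)]

lemma RegularlyVarying.exists_tendsto_natCast_mul_runningMean {f : ℝ → ℝ}
    (hf : RegularlyVarying f (-1)) (hanti : Antitone f) (hpos : ∀ x, 0 < f x) :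
    ∃ a : ℕ → ℝ, Tendsto a atTop atTop ∧
      Tendsto (fun n : ℕ => n * runningMean f (a n)) atTop (𝓝 1) :=
  exists_tendsto_natCast_mul_one (antitone_runningMean hanti) (runningMean_pos hanti hpos)
    (continuousOn_runningMean hanti) (hf.tendsto_runningMean_zero hanti hpos)

section KernelIntegral

variable {f k : ℝ → ℝ} {ρ σ : ℝ}

namespace RegularlyVarying

lemma exists_norm_mul_comp_mul_div_le (hf : RegularlyVarying f ρ) (hanti : Antitone f)
    (hpos : ∀ x, 0 < f x) (hρ : σ < ρ) (hσ : σ ≤ 0) (hk : IntegrableOn k (Set.Ioi 0))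
    (hkσ : IntegrableOn (fun x => k x * x ^ σ) (Set.Ioi 0)) :
    ∃ G : ℝ → ℝ, IntegrableOn G (Set.Ioi 0) ∧
      ∀ z > 0, ∀ᵐ x ∂volume.restrict (Set.Ioi 0), ‖k x * (f (z * x) / f z)‖ ≤ G x := by
  obtain ⟨C, -, hC⟩ := hf.exists_apply_mul_le hpos hanti hρ hσ
  refine ⟨fun x => C * (‖k x‖ + ‖k x * x ^ σ‖), (hk.norm.add hkσ.norm).const_mul C,
    fun z hz => ae_restrict_of_forall_mem measurableSet_Ioi fun x hx => ?_⟩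
  beta_reduce
  rw [norm_mul, norm_mul, Real.norm_of_nonneg (Real.rpow_nonneg (le_of_lt hx) σ),
    Real.norm_of_nonneg (div_pos (hpos _) (hpos z)).le]
  calc ‖k x‖ * (f (z * x) / f z) ≤ ‖k x‖ * (C * (1 + x ^ σ)) := by
        gcongr
        exact (div_le_iff₀ (hpos z)).2 (hC x z hx hz)
    _ = C * (‖k x‖ + ‖k x‖ * x ^ σ) := by ring

/-- The Abelian theorem for kernel integrals: Potter's bound supplies the dominating function. -/
lemma tendsto_integral_mul_comp_mul_div (hf : RegularlyVarying f ρ) (hanti : Antitone f)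
    (hpos : ∀ x, 0 < f x) (hρ : σ < ρ) (hσ : σ ≤ 0) (hk : IntegrableOn k (Set.Ioi 0))
    (hkσ : IntegrableOn (fun x => k x * x ^ σ) (Set.Ioi 0)) :
    Tendsto (fun z => (∫ x in Set.Ioi 0, k x * f (z * x)) / f z) atTop
      (𝓝 (∫ x in Set.Ioi 0, k x * x ^ ρ)) := by
  obtain ⟨G, hG, hle⟩ := hf.exists_norm_mul_comp_mul_div_le hanti hpos hρ hσ hk hkσ
  simp_rw [← integral_div, mul_div_assoc]
  refine tendsto_integral_filter_of_dominated_convergence G (.of_forall fun z => ?_)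
    ((eventually_gt_atTop 0).mono hle) hG
    (ae_restrict_of_forall_mem measurableSet_Ioi fun x hx => ?_)
  · exact hk.aestronglyMeasurable.mul
      ((hanti.measurable.comp (measurable_const_mul z)).div_const _).aestronglyMeasurable
  · simpa only [mul_comm x] using (hf x hx).const_mul (k x)

lemma exists_norm_integral_mul_comp_mul_le (hf : RegularlyVarying f ρ) (hanti : Antitone f)
    (hpos : ∀ x, 0 < f x) (hρ : σ < ρ) (hσ : σ ≤ 0) (hk : IntegrableOn k (Set.Ioi 0))
    (hkσ : IntegrableOn (fun x => k x * x ^ σ) (Set.Ioi 0)) :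
    ∃ C, ∀ z > 0, ‖∫ x in Set.Ioi 0, k x * f (z * x)‖ ≤ C * f z := by
  obtain ⟨G, hG, hle⟩ := hf.exists_norm_mul_comp_mul_div_le hanti hpos hρ hσ hk hkσ
  refine ⟨∫ x in Set.Ioi 0, G x, fun z hz => ?_⟩
  have h := norm_integral_le_of_norm_le hG (hle z hz)
  simp_rw [← mul_div_assoc] at h
  rwa [integral_div, norm_div, Real.norm_of_nonneg (hpos z).le, div_le_iff₀ (hpos z)] at h

end RegularlyVarying

lemma integrableOn_mul_comp_mul_of_antitone (hanti : Antitone f) (hnonneg : ∀ x, 0 ≤ f x)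
    (hk : IntegrableOn k (Set.Ioi 0)) {z : ℝ} (hz : 0 ≤ z) :
    IntegrableOn (fun x => k x * f (z * x)) (Set.Ioi 0) :=
  Integrable.mul_bdd (c := f 0) hk
    (hanti.measurable.comp (measurable_const_mul z)).aestronglyMeasurable
    (ae_restrict_of_forall_mem measurableSet_Ioi fun x hx => by
      rw [Real.norm_of_nonneg (hnonneg _)]
      exact hanti (mul_nonneg hz (le_of_lt hx)))

/-- The kernel comparing the exponential mean of `f` with its mean over `[0, z]`. It vanishes
linearly at `0`, which is what makes the difference of the two means of the order of `f`. -/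
noncomputable def expSubIndicator (x : ℝ) : ℝ :=
  Real.exp (-x) - (Set.Ioc 0 1).indicator 1 x

lemma integrableOn_expSubIndicator : IntegrableOn expSubIndicator (Set.Ioi 0) :=
  (integrableOn_exp_neg_Ioi 0).sub
    ((integrable_indicator_iff measurableSet_Ioc).2
      (integrableOn_const (by simp) (C := (1 : ℝ)))).integrableOn

lemma integrableOn_expSubIndicator_mul_rpow {σ : ℝ} (hσ : -2 < σ) (hσ0 : σ ≤ 0) :
    IntegrableOn (fun x => expSubIndicator x * x ^ σ) (Set.Ioi 0) := by
  rw [← Set.Ioc_union_Ioi_eq_Ioi (zero_le_one (α := ℝ)), integrableOn_union]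
  have hmeas : ∀ s, s ⊆ Set.Ioi 0 → AEStronglyMeasurable (fun x => expSubIndicator x * x ^ σ)
      (volume.restrict s) := fun s hs =>
    (integrableOn_expSubIndicator.mono_set hs).aestronglyMeasurable.mul
      (by fun_prop : Measurable fun x : ℝ => x ^ σ).aestronglyMeasurable
  constructor
  · have hint : IntegrableOn (fun x : ℝ => x ^ (1 + σ)) (Set.Ioc 0 1) :=
      (intervalIntegral.intervalIntegrable_rpow' (by linarith)).1
    refine hint.mono' (hmeas _ Set.Ioc_subset_Ioi_self)
      (ae_restrict_of_forall_mem measurableSet_Ioc fun x hx => ?_)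
    have hx0 := hx.1
    have hexp := Real.one_sub_le_exp_neg x
    have hexp1 := Real.exp_le_one_iff.2 (neg_nonpos.2 hx0.le)
    rw [expSubIndicator, Set.indicator_of_mem hx, Pi.one_apply, norm_mul,
      Real.norm_of_nonneg (by positivity : 0 ≤ x ^ σ), Real.norm_of_nonpos (by linarith),
      Real.rpow_add hx0, Real.rpow_one]
    gcongr
    linarith
  · refine (integrableOn_exp_neg_Ioi 1).mono'
      (hmeas _ (Set.Ioi_subset_Ioi zero_le_one))
      (ae_restrict_of_forall_mem measurableSet_Ioi fun x hx => ?_)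
    have hx1 : 1 < x := hx
    rw [expSubIndicator, Set.indicator_of_notMem (fun h => hx1.not_ge h.2), sub_zero,
      Real.norm_of_nonneg (by positivity)]
    exact mul_le_of_le_one_right (by positivity) (Real.rpow_le_one_of_one_le_of_nonpos hx1.le hσ0)

lemma integral_expSubIndicator_mul (hanti : Antitone f) (hnonneg : ∀ x, 0 ≤ f x) {z : ℝ}
    (hz : 0 ≤ z) : ∫ x in Set.Ioi 0, expSubIndicator x * f (z * x) =
      (∫ x in Set.Ioi 0, Real.exp (-x) * f (z * x)) - runningMean f z := by
  have hind : ∀ x, (Set.Ioc (0 : ℝ) 1).indicator 1 x * f (z * x) =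
      (Set.Ioc 0 1).indicator (fun x => f (z * x)) x := fun x => by
    simp only [Set.indicator_apply, Pi.one_apply, ite_mul, one_mul, zero_mul]
  simp_rw [expSubIndicator, sub_mul, hind]
  rw [integral_sub (integrableOn_mul_comp_mul_of_antitone hanti hnonneg
      (integrableOn_exp_neg_Ioi 0) hz), setIntegral_indicator measurableSet_Ioc,
    Set.inter_eq_right.2 Set.Ioc_subset_Ioi_self, runningMean,
    intervalIntegral.integral_of_le zero_le_one]
  exact ((integrable_indicator_iff measurableSet_Ioc).2
    (intervalIntegrable_comp_mul_left hanti z 0 1).1).integrableOn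

lemma RegularlyVarying.integral_exp_neg_mul_isEquivalent (hf : RegularlyVarying f (-1))
    (hanti : Antitone f) (hpos : ∀ x, 0 < f x) :
    (fun z => ∫ x in Set.Ioi 0, Real.exp (-x) * f (z * x)) ~[atTop] runningMean f := by
  obtain ⟨C, hC⟩ := hf.exists_norm_integral_mul_comp_mul_le hanti hpos (σ := -(3 / 2))
    (by norm_num) (by norm_num) integrableOn_expSubIndicator
    (integrableOn_expSubIndicator_mul_rpow (by norm_num) (by norm_num))
  refine IsBigO.trans_isLittleO (IsBigO.of_bound C ?_) (hf.isLittleO_runningMean hanti hpos)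
  filter_upwards [eventually_gt_atTop 0] with z hz
  rw [Pi.sub_apply, ← integral_expSubIndicator_mul hanti (fun x => (hpos x).le) hz.le,
    Real.norm_of_nonneg (hpos z).le]
  exact hC z hz

end KernelIntegral

section LayerCake

variable {Ω : Type*} [MeasurableSpace Ω] {μ : Measure Ω} {X : Ω → ℝ}

/-- The tail function `x ↦ P(X > x)`. -/
noncomputable def tailProb (μ : Measure Ω) (X : Ω → ℝ) (x : ℝ) : ℝ := μ.real {ω | x < X ω}

lemma antitone_tailProb [IsFiniteMeasure μ] : Antitone (tailProb μ X) := fun _ _ hxy =>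
  measureReal_mono fun _ hω => hxy.trans_lt hω

lemma isBigO_one_tailProb [IsProbabilityMeasure μ] {l : Filter ℝ} :
    tailProb μ X =O[l] fun _ => (1 : ℝ) :=
  .of_bound' (.of_forall fun _ => by
    rw [norm_one, tailProb, Real.norm_of_nonneg measureReal_nonneg]
    exact measureReal_le_one)

lemma tailProb_div {z : ℝ} (hz : 0 < z) (x : ℝ) :
    tailProb μ (fun ω => X ω / z) x = tailProb μ X (z * x) := by
  simp only [tailProb, lt_div_iff₀' hz]

/-- A layer-cake formula in which the derivative `k'` may change sign. -/
lemma integral_comp_eq_integral_mul_tailProb [IsFiniteMeasure μ] (hX : Measurable X)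
    (hX0 : ∀ ω, 0 ≤ X ω) {k k' : ℝ → ℝ} (hk0 : k 0 = 0) (hk : ContinuousOn k (Set.Ici 0))
    (hk' : ∀ x > 0, HasDerivAt k (k' x) x) (hint : IntegrableOn k' (Set.Ioi 0)) :
    ∫ ω, k (X ω) ∂μ = ∫ x in Set.Ioi 0, k' x * tailProb μ X x := by
  have hrep : ∀ ω, k (X ω) = ∫ x in Set.Ioi 0, (Set.Iio (X ω)).indicator k' x := fun ω => by
    rw [setIntegral_indicator measurableSet_Iio, Set.Ioi_inter_Iio,
      ← integral_Ioc_eq_integral_Ioo, ← intervalIntegral.integral_of_le (hX0 ω),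
      intervalIntegral.integral_eq_sub_of_hasDerivAt_of_le (hX0 ω)
        (hk.mono Set.Icc_subset_Ici_self) (fun x hx => hk' x hx.1)
        ((intervalIntegrable_iff_integrableOn_Ioc_of_le (hX0 ω)).2
          (hint.mono_set Set.Ioc_subset_Ioi_self)), hk0, sub_zero]
  have hprod : Integrable (Function.uncurry fun ω x => (Set.Iio (X ω)).indicator k' x)
      (μ.prod (volume.restrict (Set.Ioi 0))) :=
    (Integrable.comp_snd hint μ).indicator
      (measurableSet_lt measurable_snd (hX.comp measurable_fst))
  simp_rw [hrep]
  rw [integral_integral_swap hprod]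
  refine integral_congr_ae (.of_forall fun x => ?_)
  calc ∫ ω, (Set.Iio (X ω)).indicator k' x ∂μ
      = ∫ ω, {ω | x < X ω}.indicator (fun _ => k' x) ω ∂μ := rfl
    _ = k' x * tailProb μ X x := by
      rw [integral_indicator_const _ (measurableSet_lt measurable_const hX), smul_eq_mul,
        mul_comm, tailProb]

lemma integrable_exp_neg_mul [IsFiniteMeasure μ] (hX : Measurable X) (hX0 : ∀ ω, 0 ≤ X ω) {t : ℝ}
    (ht : 0 ≤ t) : Integrable (fun ω => Real.exp (-t * X ω)) μ := by
  simpa only [neg_mul, mul_neg] using integrable_exp_mul_of_le (X := fun ω => -X ω) t 0 ht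
    hX.neg.aemeasurable (.of_forall fun ω => neg_nonpos.2 (hX0 ω))

lemma antitoneOn_mgf_neg [IsFiniteMeasure μ] (hX : Measurable X) (hX0 : ∀ ω, 0 ≤ X ω) :
    AntitoneOn (fun t => mgf X μ (-t)) (Set.Ici 0) := fun _ hs _ ht hst =>
  integral_mono (integrable_exp_neg_mul hX hX0 ht) (integrable_exp_neg_mul hX hX0 hs) fun ω =>
    Real.exp_le_exp.2 (mul_le_mul_of_nonneg_right (neg_le_neg hst) (hX0 ω))

lemma one_sub_mgf_neg_inv [IsProbabilityMeasure μ] (hX : Measurable X) (hX0 : ∀ ω, 0 ≤ X ω)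
    {z : ℝ} (hz : 0 < z) :
    1 - mgf X μ (-z⁻¹) = ∫ x in Set.Ioi 0, Real.exp (-x) * tailProb μ X (z * x) := by
  have hlayer := integral_comp_eq_integral_mul_tailProb (μ := μ) (X := fun ω => X ω / z)
    (k := fun x => 1 - Real.exp (-x)) (hX.div_const z) (fun ω => div_nonneg (hX0 ω) hz.le)
    (by simp) (by fun_prop) (fun x _ => by simpa using (hasDerivAt_neg x).exp.const_sub 1)
    (integrableOn_exp_neg_Ioi 0)
  have hint : Integrable (fun ω => Real.exp (-(X ω / z))) μ := by
    simpa only [neg_mul, inv_mul_eq_div] using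
      integrable_exp_neg_mul (μ := μ) hX hX0 (inv_nonneg.2 hz.le)
  simp_rw [tailProb_div hz] at hlayer
  rw [← hlayer, integral_sub (integrable_const _) hint, integral_const, probReal_univ,
    one_smul, mgf]
  simp only [div_eq_inv_mul, neg_mul]

lemma RegularlyVarying.one_sub_mgf_neg_inv_isEquivalent [IsProbabilityMeasure μ]
    (hRV : RegularlyVarying (tailProb μ X) (-1)) (hX : Measurable X) (hX0 : ∀ ω, 0 ≤ X ω) :
    (fun z => 1 - mgf X μ (-z⁻¹)) ~[atTop] runningMean (tailProb μ X) := by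
  refine (hRV.integral_exp_neg_mul_isEquivalent antitone_tailProb
    (hRV.pos antitone_tailProb fun _ => measureReal_nonneg)).congr_left ?_
  filter_upwards [eventually_gt_atTop 0] with z hz
  rw [one_sub_mgf_neg_inv hX hX0 hz]

end LayerCake

section GammaKernel

/-- The derivative of the kernel `x ^ γ * exp (-x)` of the Gamma integral. -/
noncomputable def gammaKernelDeriv (γ x : ℝ) : ℝ :=
  γ * (Real.exp (-x) * x ^ (γ - 1)) - Real.exp (-x) * x ^ γ

variable {γ : ℝ}

lemma hasDerivAt_gammaKernel {x : ℝ} (hx : x ≠ 0) :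
    HasDerivAt (fun x => x ^ γ * Real.exp (-x)) (gammaKernelDeriv γ x) x := by
  refine ((Real.hasDerivAt_rpow_const (.inl hx)).mul (hasDerivAt_neg x).exp).congr_deriv ?_
  rw [gammaKernelDeriv]
  ring

lemma gammaKernelDeriv_mul_rpow {p x : ℝ} (hx : 0 < x) :
    gammaKernelDeriv γ x * x ^ p =
      γ * (Real.exp (-x) * x ^ (γ + p - 1)) - Real.exp (-x) * x ^ (γ + p + 1 - 1) := by
  rw [gammaKernelDeriv, sub_mul, mul_assoc, mul_assoc, mul_assoc, ← Real.rpow_add hx,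
    ← Real.rpow_add hx]
  ring_nf

lemma integrableOn_gammaKernelDeriv_mul_rpow {p : ℝ} (hp : 0 < γ + p) :
    IntegrableOn (fun x => gammaKernelDeriv γ x * x ^ p) (Set.Ioi 0) :=
  IntegrableOn.congr_fun (((Real.GammaIntegral_convergent hp).const_mul γ).sub
    (Real.GammaIntegral_convergent (by linarith)))
    (fun _ hx => (gammaKernelDeriv_mul_rpow hx).symm) measurableSet_Ioi

lemma integrableOn_gammaKernelDeriv (hγ : 0 < γ) :
    IntegrableOn (gammaKernelDeriv γ) (Set.Ioi 0) := by
  simpa only [Real.rpow_zero, mul_one] using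
    integrableOn_gammaKernelDeriv_mul_rpow (p := 0) (by rwa [add_zero])

lemma integral_gammaKernelDeriv_mul_rpow {p : ℝ} (hp : 0 < γ + p) :
    ∫ x in Set.Ioi 0, gammaKernelDeriv γ x * x ^ p = -p * Real.Gamma (γ + p) := by
  rw [setIntegral_congr_fun measurableSet_Ioi fun _ hx => gammaKernelDeriv_mul_rpow hx,
    integral_sub ((Real.GammaIntegral_convergent hp).const_mul γ)
      (Real.GammaIntegral_convergent (by linarith)), integral_const_mul,
    ← Real.Gamma_eq_integral hp, ← Real.Gamma_eq_integral (by linarith), Real.Gamma_add_one hp.ne']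
  ring

variable {Ω : Type*} [MeasurableSpace Ω] {μ : Measure Ω} {X : Ω → ℝ}

/-- The mean `E[(tX) ^ γ * exp (-tX)]` of the Gamma kernel. Integrated against `t⁻¹ dt` and
multiplied by a power of the Laplace transform of `X` it produces the moments of
self-normalised sums. -/
noncomputable def gammaMean (μ : Measure Ω) (X : Ω → ℝ) (γ t : ℝ) : ℝ :=
  ∫ ω, (t * X ω) ^ γ * Real.exp (-(t * X ω)) ∂μ

lemma gammaMean_nonneg (hX0 : ∀ ω, 0 ≤ X ω) {t : ℝ} (ht : 0 ≤ t) : 0 ≤ gammaMean μ X γ t :=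
  integral_nonneg fun ω => mul_nonneg (Real.rpow_nonneg (mul_nonneg ht (hX0 ω)) _)
    (Real.exp_pos _).le

lemma gammaMean_inv [IsFiniteMeasure μ] (hX : Measurable X) (hX0 : ∀ ω, 0 ≤ X ω) (hγ : 0 < γ)
    {z : ℝ} (hz : 0 < z) :
    gammaMean μ X γ z⁻¹ = ∫ x in Set.Ioi 0, gammaKernelDeriv γ x * tailProb μ X (z * x) := by
  have hcont : Continuous fun x : ℝ => x ^ γ * Real.exp (-x) :=
    (Real.continuous_rpow_const hγ.le).mul (by fun_prop)
  simp_rw [gammaMean, inv_mul_eq_div, ← tailProb_div hz]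
  exact integral_comp_eq_integral_mul_tailProb (k := fun x => x ^ γ * Real.exp (-x))
    (hX.div_const z) (fun ω => div_nonneg (hX0 ω) hz.le)
    (by rw [Real.zero_rpow hγ.ne', zero_mul]) hcont.continuousOn
    (fun x hx => hasDerivAt_gammaKernel hx.ne') (integrableOn_gammaKernelDeriv hγ)

namespace RegularlyVarying

variable [IsFiniteMeasure μ] {ρ : ℝ}

lemma exists_gammaMean_inv_le (hRV : RegularlyVarying (tailProb μ X) ρ)
    (hX : Measurable X) (hX0 : ∀ ω, 0 ≤ X ω) (hγ : 0 < γ) (hρ : -γ < ρ) :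
    ∃ C, ∀ z > 0, gammaMean μ X γ z⁻¹ ≤ C * tailProb μ X z := by
  obtain ⟨σ, hσγ, hσ⟩ := exists_between (lt_min hρ (neg_lt_zero.2 hγ))
  obtain ⟨hσρ, hσ0⟩ := lt_min_iff.1 hσ
  obtain ⟨C, hC⟩ := hRV.exists_norm_integral_mul_comp_mul_le antitone_tailProb
    (hRV.pos antitone_tailProb fun _ => measureReal_nonneg) hσρ hσ0.le
    (integrableOn_gammaKernelDeriv hγ) (integrableOn_gammaKernelDeriv_mul_rpow (by linarith))
  refine ⟨C, fun z hz => ?_⟩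
  rw [gammaMean_inv hX hX0 hγ hz]
  exact (le_abs_self _).trans (hC z hz)

lemma tendsto_gammaMean_inv_div (hRV : RegularlyVarying (tailProb μ X) ρ)
    (hX : Measurable X) (hX0 : ∀ ω, 0 ≤ X ω) (hγ : 0 < γ) (hρ : -γ < ρ) :
    Tendsto (fun z => gammaMean μ X γ z⁻¹ / tailProb μ X z) atTop
      (𝓝 (-ρ * Real.Gamma (γ + ρ))) := by
  obtain ⟨σ, hσγ, hσ⟩ := exists_between (lt_min hρ (neg_lt_zero.2 hγ))
  obtain ⟨hσρ, hσ0⟩ := lt_min_iff.1 hσ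
  rw [← integral_gammaKernelDeriv_mul_rpow (by linarith)]
  refine (hRV.tendsto_integral_mul_comp_mul_div antitone_tailProb
    (hRV.pos antitone_tailProb fun _ => measureReal_nonneg) hσρ hσ0.le
    (integrableOn_gammaKernelDeriv hγ)
    (integrableOn_gammaKernelDeriv_mul_rpow (by linarith))).congr' ?_
  filter_upwards [eventually_gt_atTop 0] with z hz
  rw [gammaMean_inv hX hX0 hγ hz]

end RegularlyVarying

end GammaKernel

section GammaRepresentation

lemma integrableOn_gammaIntegrand {γ x s : ℝ} (hγ : 0 < γ) (hx : 0 ≤ x) (hxs : x ≤ s) :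
    IntegrableOn (fun t => t⁻¹ * ((t * x) ^ γ * Real.exp (-(t * s)))) (Set.Ioi 0) ∧
      ∫ t in Set.Ioi 0, t⁻¹ * ((t * x) ^ γ * Real.exp (-(t * s))) =
        Real.Gamma γ * (x / s) ^ γ := by
  rcases hx.eq_or_lt with rfl | hx
  · simp [Real.zero_rpow hγ.ne']
  have hs : 0 < s := hx.trans_le hxs
  have hint := Real.integral_rpow_mul_exp_neg_mul_Ioi hγ hs
  have heq : Set.EqOn (fun t => x ^ γ * (t ^ (γ - 1) * Real.exp (-(s * t))))
      (fun t => t⁻¹ * ((t * x) ^ γ * Real.exp (-(t * s)))) (Set.Ioi 0) := fun t ht => by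
    have ht : 0 < t := ht
    simp only [Real.mul_rpow ht.le hx.le, Real.rpow_sub_one ht.ne', mul_comm s]
    field_simp
  constructor
  · refine IntegrableOn.congr_fun (Integrable.const_mul (.of_integral_ne_zero ?_) _) heq
      measurableSet_Ioi
    have := Real.Gamma_pos_of_pos hγ
    rw [hint]
    positivity
  · rw [← setIntegral_congr_fun measurableSet_Ioi heq, integral_const_mul, hint,
      Real.div_rpow hx.le hs.le, Real.div_rpow zero_le_one hs.le, Real.one_rpow]
    ring

variable {Ω : Type*} [MeasurableSpace Ω] {μ : Measure Ω}

lemma integrable_gammaIntegrand_prod [IsFiniteMeasure μ] {X S : Ω → ℝ} (hX : Measurable X)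
    (hS : Measurable S) (hX0 : ∀ ω, 0 ≤ X ω) (hXS : ∀ ω, X ω ≤ S ω) {γ : ℝ} (hγ : 0 < γ) :
    Integrable (Function.uncurry fun ω t => t⁻¹ * ((t * X ω) ^ γ * Real.exp (-(t * S ω))))
      (μ.prod (volume.restrict (Set.Ioi 0))) := by
  have hmeas : Measurable
      (Function.uncurry fun ω t => t⁻¹ * ((t * X ω) ^ γ * Real.exp (-(t * S ω)))) := by
    unfold Function.uncurry
    fun_prop
  refine (integrable_prod_iff hmeas.aestronglyMeasurable).2
    ⟨.of_forall fun ω => (integrableOn_gammaIntegrand hγ (hX0 ω) (hXS ω)).1, ?_⟩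
  have hratio : Integrable (fun ω => Real.Gamma γ * (X ω / S ω) ^ γ) μ := by
    refine ((integrable_const (1 : ℝ)).mono'
      (hX.div hS |>.pow_const γ).aestronglyMeasurable (.of_forall fun ω => ?_)).const_mul _
    have hS0 := (hX0 ω).trans (hXS ω)
    have hdiv : 0 ≤ X ω / S ω := div_nonneg (hX0 ω) hS0
    rw [Real.norm_of_nonneg (by positivity)]
    exact Real.rpow_le_one hdiv (div_le_one_of_le₀ (hXS ω) hS0) hγ.le
  refine hratio.congr (.of_forall fun ω => ?_)
  beta_reduce
  rw [← (integrableOn_gammaIntegrand hγ (hX0 ω) (hXS ω)).2]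
  refine setIntegral_congr_fun measurableSet_Ioi fun t ht => (Real.norm_of_nonneg ?_).symm
  have ht : 0 < t := ht
  have := hX0 ω
  change 0 ≤ t⁻¹ * ((t * X ω) ^ γ * Real.exp (-(t * S ω)))
  positivity

variable {ι : Type*} {X : ι → Ω → ℝ}

lemma integral_mul_exp_mul_sum_of_iid (hX : ∀ i, Measurable (X i)) (hindep : iIndepFun X μ)
    {i : ι} (hident : ∀ j, IdentDistrib (X j) (X i) μ μ) {s : Finset ι} (hi : i ∈ s) {g : ℝ → ℝ}
    (hg : Measurable g) (t : ℝ) :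
    ∫ ω, g (X i ω) * Real.exp (t * ∑ k ∈ s, X k ω) ∂μ =
      (∫ ω, g (X i ω) * Real.exp (t * X i ω) ∂μ) * mgf (X i) μ t ^ (s.card - 1) := by
  classical
  have hind : IndepFun (X i) (∑ k ∈ s.erase i, X k) μ :=
    (hindep.indepFun_finsetSum_of_notMem hX (Finset.notMem_erase i s)).symm
  have hmgf : mgf (∑ k ∈ s.erase i, X k) μ t = mgf (X i) μ t ^ (s.card - 1) := by
    rw [hindep.mgf_sum hX, Finset.prod_congr rfl fun k _ => by
      rw [mgf_congr_identDistrib (hident k)], Finset.prod_const, Finset.card_erase_of_mem hi]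
  rw [← hmgf, mgf, ← hind.integral_fun_comp_mul_comp (f := fun x => g x * Real.exp (t * x))
    (g := fun y => Real.exp (t * y)) (hX i).aemeasurable
    (Finset.aemeasurable_sum _ fun k _ => (hX k).aemeasurable)
    (by fun_prop) (by fun_prop)]
  refine integral_congr_ae (.of_forall fun ω => ?_)
  simp only [← Finset.add_sum_erase s (fun k => X k ω) hi, Finset.sum_apply, mul_add,
    Real.exp_add, mul_assoc]

lemma integral_gammaIntegrand_of_iid (hX : ∀ i, Measurable (X i)) (hindep : iIndepFun X μ)
    {i : ι} (hident : ∀ j, IdentDistrib (X j) (X i) μ μ) {s : Finset ι} (hi : i ∈ s) (γ t : ℝ) :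
    ∫ ω, t⁻¹ * ((t * X i ω) ^ γ * Real.exp (-(t * ∑ k ∈ s, X k ω))) ∂μ =
      t⁻¹ * (gammaMean μ (X i) γ t * mgf (X i) μ (-t) ^ (s.card - 1)) := by
  have h := integral_mul_exp_mul_sum_of_iid hX hindep hident hi
    (g := fun x => (t * x) ^ γ) (by fun_prop) (-t)
  simp only [neg_mul] at h
  rw [integral_const_mul, h, gammaMean]

lemma integrableOn_gammaMean_mul_mgf_pow [IsFiniteMeasure μ] (hX : ∀ i, Measurable (X i))
    (hX0 : ∀ i ω, 0 ≤ X i ω) (hindep : iIndepFun X μ) {i : ι}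
    (hident : ∀ j, IdentDistrib (X j) (X i) μ μ) {s : Finset ι} (hi : i ∈ s) {γ : ℝ}
    (hγ : 0 < γ) :
    IntegrableOn (fun t => t⁻¹ * (gammaMean μ (X i) γ t * mgf (X i) μ (-t) ^ (s.card - 1)))
      (Set.Ioi 0) := by
  simp_rw [← integral_gammaIntegrand_of_iid hX hindep hident hi γ]
  exact (integrable_gammaIntegrand_prod (hX i) (Finset.measurable_sum s fun k _ => hX k) (hX0 i)
    (fun ω => Finset.single_le_sum (f := fun k => X k ω) (fun k _ => hX0 k ω) hi)
    hγ).integral_prod_right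

/-- The Gamma integral turns the quotient `X i / ∑ X k` into an exponential of the sum, which
factorises by independence. -/
lemma integral_gammaMean_mul_mgf_pow [IsFiniteMeasure μ] (hX : ∀ i, Measurable (X i))
    (hX0 : ∀ i ω, 0 ≤ X i ω) (hindep : iIndepFun X μ) {i : ι}
    (hident : ∀ j, IdentDistrib (X j) (X i) μ μ) {s : Finset ι} (hi : i ∈ s) {γ : ℝ}
    (hγ : 0 < γ) :
    ∫ t in Set.Ioi 0, t⁻¹ * (gammaMean μ (X i) γ t * mgf (X i) μ (-t) ^ (s.card - 1)) =
      Real.Gamma γ * ∫ ω, (X i ω / ∑ k ∈ s, X k ω) ^ γ ∂μ := by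
  have hXS : ∀ ω, X i ω ≤ ∑ k ∈ s, X k ω := fun ω =>
    Finset.single_le_sum (f := fun k => X k ω) (fun k _ => hX0 k ω) hi
  simp_rw [← integral_gammaIntegrand_of_iid hX hindep hident hi γ]
  rw [← integral_integral_swap (integrable_gammaIntegrand_prod (hX i)
    (Finset.measurable_sum s fun k _ => hX k) (hX0 i) hXS hγ), ← integral_const_mul]
  exact integral_congr_ae (.of_forall fun ω => (integrableOn_gammaIntegrand hγ (hX0 i ω) (hXS ω)).2)

end GammaRepresentation

namespace RegularlyVarying

/-- Both of Potter's bounds at once, with `u` dividing the argument: the exponents `-τ` and `-σ`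
govern `u ≤ 1` and `1 ≤ u`. -/
lemma exists_eventually_apply_div_le {f : ℝ → ℝ} {ρ σ τ : ℝ} (hf : RegularlyVarying f ρ)
    (hpos : ∀ x, 0 < f x) (hanti : Antitone f) (hσ : σ < ρ) (hρ : ρ < τ) (hτ : τ ≤ 0) :
    ∃ C, ∀ᶠ z in atTop, ∀ u > 0, f (z / u) ≤ C * (u ^ (-τ) + u ^ (-σ)) * f z := by
  obtain ⟨x₀, hx₀, hsmall⟩ := hf.exists_le_rpow_mul hpos hanti hρ hτ
  obtain ⟨C, hC, hlarge⟩ := hf.exists_apply_mul_le hpos hanti hσ (hσ.trans hρ |>.le.trans hτ)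
  refine ⟨2 ^ (-τ) + 2 * C, (eventually_ge_atTop x₀).mono fun z hz u hu => ?_⟩
  have hz0 : 0 < z := hx₀.trans_le hz
  have hfz := hpos z
  have h2 : (0 : ℝ) < 2 ^ (-τ) := by positivity
  have huτ : 0 < u ^ (-τ) := by positivity
  have huσ : 0 < u ^ (-σ) := by positivity
  rcases le_total u 1 with hu1 | hu1
  · calc f (z / u) ≤ (z / u / (2 * z)) ^ τ * f z := hsmall _ _ hz (le_div_self hz0.le hu hu1)
      _ = 2 ^ (-τ) * u ^ (-τ) * f z := by
        rw [← Real.mul_rpow two_pos.le hu.le, Real.rpow_neg (by positivity),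
          ← Real.inv_rpow (by positivity)]
        congr 2
        field_simp
      _ ≤ _ := by gcongr <;> linarith
  · have hone : 1 ≤ u ^ (-σ) := Real.one_le_rpow hu1 (by linarith)
    calc f (z / u) ≤ C * (1 + u⁻¹ ^ σ) * f z := hlarge _ _ (inv_pos.2 hu) hz0
      _ ≤ C * (u ^ (-σ) + u ^ (-σ)) * f z := by
        rw [Real.inv_rpow hu.le, ← Real.rpow_neg hu.le]
        gcongr
      _ = 2 * C * u ^ (-σ) * f z := by ring
      _ ≤ _ := by gcongr <;> linarith

end RegularlyVarying

section LaplaceMethod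

lemma integral_inv_mul_comp_div (g : ℝ → ℝ) {r : ℝ} (hr : 0 < r) :
    ∫ u in Set.Ioi 0, u⁻¹ * g (u / r) = ∫ t in Set.Ioi 0, t⁻¹ * g t := by
  have h := integral_comp_mul_left_Ioi (fun t => t⁻¹ * g t) 0 (inv_pos.2 hr)
  simp only [mul_zero, inv_inv, smul_eq_mul, mul_inv, mul_assoc, integral_const_mul] at h
  simpa only [inv_mul_eq_div] using mul_left_cancel₀ hr.ne' h

lemma integrableOn_inv_mul_comp_div {g : ℝ → ℝ}
    (hg : IntegrableOn (fun t => t⁻¹ * g t) (Set.Ioi 0)) {r : ℝ} (hr : 0 < r) :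
    IntegrableOn (fun u => u⁻¹ * g (u / r)) (Set.Ioi 0) := by
  have h := (integrableOn_Ioi_comp_mul_left_iff (fun t => t⁻¹ * g t) 0 (inv_pos.2 hr)).2
    (by rwa [mul_zero])
  refine IntegrableOn.congr_fun (h.const_mul r⁻¹) (fun u _ => ?_) measurableSet_Ioi
  simp only [inv_mul_eq_div]
  field_simp

variable {f T h φ : ℝ → ℝ} {a : ℕ → ℝ}

lemma tendsto_natCast_mul_one_sub_comp_div (hf : RegularlyVarying f (-1))
    (hφ : (fun z => 1 - φ z⁻¹) ~[atTop] f) (ha : Tendsto a atTop atTop)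
    (hna : Tendsto (fun n : ℕ => n * f (a n)) atTop (𝓝 1)) {u : ℝ} (hu : 0 < u) :
    Tendsto (fun n : ℕ => n * (1 - φ (u / a n))) atTop (𝓝 u) := by
  have hequiv : (fun n : ℕ => n * (1 - φ (u / a n))) ~[atTop]
      fun n : ℕ => n * f (u⁻¹ * a n) := by
    have := hφ.comp_tendsto (ha.const_mul_atTop (inv_pos.2 hu))
    simp only [Function.comp_def, mul_inv, inv_inv, ← div_eq_mul_inv] at this
    exact IsEquivalent.refl.mul this
  refine hequiv.symm.tendsto_nhds ?_
  have hlim := hna.mul ((hf _ (inv_pos.2 hu)).comp ha)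
  rw [Real.rpow_neg_one, inv_inv, one_mul] at hlim
  refine hlim.congr' ?_
  filter_upwards [hna.eventually_ne one_ne_zero] with n hn
  have := right_ne_zero_of_mul hn
  simp only [Function.comp]
  field_simp

lemma tendsto_comp_div_pow_exp_neg (hf : RegularlyVarying f (-1))
    (hφ : (fun z => 1 - φ z⁻¹) ~[atTop] f) (ha : Tendsto a atTop atTop)
    (hna : Tendsto (fun n : ℕ => n * f (a n)) atTop (𝓝 1)) {u : ℝ} (hu : 0 < u) :
    Tendsto (fun n : ℕ => φ (u / a n) ^ (n - 1)) atTop (𝓝 (Real.exp (-u))) := by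
  have hmul := tendsto_natCast_mul_one_sub_comp_div hf hφ ha hna hu
  have hone : Tendsto (fun n => φ (u / a n)) atTop (𝓝 1) := by
    have := (hmul.mul tendsto_inv_atTop_nhds_zero_nat).const_sub 1
    rw [mul_zero, sub_zero] at this
    refine this.congr' ((eventually_ne_atTop 0).mono fun n hn => ?_)
    have : (n : ℝ) ≠ 0 := by exact_mod_cast hn
    field_simp
    ring
  have hpow : Tendsto (fun n : ℕ => φ (u / a n) ^ n) atTop (𝓝 (Real.exp (-u))) := by
    have := Real.tendsto_one_add_pow_exp_of_tendsto (g := fun n => φ (u / a n) - 1) (t := -u)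
      (by simpa only [← mul_neg, neg_sub] using hmul.neg)
    simpa only [add_sub_cancel] using this
  have hdiv := hpow.div hone one_ne_zero
  rw [div_one] at hdiv
  refine hdiv.congr' ?_
  filter_upwards [hone.eventually_ne one_ne_zero, eventually_ge_atTop 1] with n hn hn1
  rw [Pi.div_apply, div_eq_iff hn, pow_sub_one_mul (by omega)]

lemma exists_mul_le_one_sub_comp_div (hf : RegularlyVarying f (-1)) (hanti : Antitone f)
    (hpos : ∀ x, 0 < f x) (hφ : (fun z => 1 - φ z⁻¹) ~[atTop] f) :
    ∃ t₀ > 0, ∀ u > 0, ∀ z > 0, u / z ≤ t₀ →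
      max 0 (u ^ (1 / 2 : ℝ) - 1) / 4 * f z ≤ 1 - φ (u / z) := by
  obtain ⟨x₀, hx₀, hpotter⟩ := hf.exists_le_rpow_mul hpos hanti (σ := -(1 / 2)) (by norm_num)
    (by norm_num)
  obtain ⟨x₁, hhalf⟩ := eventually_atTop.1 (hφ.isLittleO.def one_half_pos)
  refine ⟨(max x₀ x₁)⁻¹, by positivity, fun u hu z hz huz => ?_⟩
  have hmax : max x₀ x₁ ≤ z / u := by
    rw [← inv_div] at huz
    exact (inv_le_inv₀ (by positivity) (by positivity)).1 huz
  have hφf : f (z / u) / 2 ≤ 1 - φ (u / z) := by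
    have := neg_le_of_abs_le (hhalf _ ((le_max_right x₀ x₁).trans hmax))
    rw [Real.norm_of_nonneg (hpos _).le, Pi.sub_apply, inv_div] at this
    linarith
  refine le_trans ?_ hφf
  have hfz := hpos z
  rcases le_total u 1 with hu1 | hu1
  · rw [max_eq_left (sub_nonpos.2 (Real.rpow_le_one hu.le hu1 (by norm_num))), zero_div, zero_mul]
    exact (half_pos (hpos _)).le
  · have hsqrt : u ^ (1 / 2 : ℝ) / 2 ≤ (u / 2) ^ (1 / 2 : ℝ) := by
      rw [Real.div_rpow hu.le two_pos.le]
      gcongr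
      exact Real.rpow_le_self_of_one_le one_le_two (by norm_num)
    have hcomp := hpotter (z / u) z ((le_max_left x₀ x₁).trans hmax) (div_le_self hz.le hu1)
    rw [show z / (2 * (z / u)) = u / 2 by field_simp, Real.rpow_neg (by positivity),
      le_inv_mul_iff₀ (by positivity)] at hcomp
    have hmax' : max 0 (u ^ (1 / 2 : ℝ) - 1) ≤ u ^ (1 / 2 : ℝ) := max_le (by positivity) (by simp)
    calc max 0 (u ^ (1 / 2 : ℝ) - 1) / 4 * f z ≤ u ^ (1 / 2 : ℝ) / 2 * f z / 2 := by
          linarith [mul_le_mul_of_nonneg_right hmax' hfz.le]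
      _ ≤ f (z / u) / 2 := by
          gcongr
          exact (mul_le_mul_of_nonneg_right hsqrt hfz.le).trans hcomp

lemma exists_eventually_comp_div_pow_le (hf : RegularlyVarying f (-1)) (hanti : Antitone f)
    (hpos : ∀ x, 0 < f x) (hφ : (fun z => 1 - φ z⁻¹) ~[atTop] f) (hφ0 : ∀ t, 0 ≤ φ t)
    (ha : Tendsto a atTop atTop) (hna : Tendsto (fun n : ℕ => n * f (a n)) atTop (𝓝 1)) :
    ∃ t₀ > 0, ∀ᶠ n in atTop, ∀ u > 0, u / a n ≤ t₀ →
      φ (u / a n) ^ (n - 1) ≤ Real.exp ((1 - u ^ (1 / 2 : ℝ)) / 16) := by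
  obtain ⟨t₀, ht₀, hle⟩ := exists_mul_le_one_sub_comp_div hf hanti hpos hφ
  refine ⟨t₀, ht₀, ?_⟩
  filter_upwards [ha.eventually_gt_atTop 0, hna.eventually_const_lt one_half_lt_one,
    eventually_ge_atTop 2] with n han hn hn2 u hu hut
  have hrate : 1 / 4 ≤ (n - 1 : ℕ) * f (a n) := by
    have hn2' : (2 : ℝ) ≤ n := by exact_mod_cast hn2
    rw [Nat.cast_pred (by omega)]
    nlinarith [hpos (a n)]
  calc φ (u / a n) ^ (n - 1) ≤ Real.exp (-(1 - φ (u / a n))) ^ (n - 1) := by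
        gcongr
        · exact hφ0 _
        · linarith [Real.add_one_le_exp (-(1 - φ (u / a n)))]
    _ = Real.exp (-((n - 1 : ℕ) * (1 - φ (u / a n)))) := by rw [← Real.exp_nat_mul, mul_neg]
    _ ≤ Real.exp ((1 - u ^ (1 / 2 : ℝ)) / 16) := by
      gcongr
      have := mul_le_mul_of_nonneg_left (hle u hu (a n) han hut) (Nat.cast_nonneg (n - 1))
      have := mul_le_mul_of_nonneg_left hrate (le_max_left 0 (u ^ (1 / 2 : ℝ) - 1))
      have := le_max_right 0 (u ^ (1 / 2 : ℝ) - 1)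
      linarith

variable {ρ C G : ℝ}

lemma tendsto_inv_mul_comp_div_div (hT : RegularlyVarying T ρ) (hTpos : ∀ x, 0 < T x)
    (hlim : Tendsto (fun z => h z⁻¹ / T z) atTop (𝓝 G)) (ha : Tendsto a atTop atTop) {u : ℝ}
    (hu : 0 < u) :
    Tendsto (fun n => u⁻¹ * h (u / a n) / T (a n)) atTop (𝓝 (G * u ^ (-ρ - 1))) := by
  have hh := hlim.comp (ha.const_mul_atTop (inv_pos.2 hu))
  have hprod := (hh.mul ((hT _ (inv_pos.2 hu)).comp ha)).const_mul u⁻¹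
  rw [Real.inv_rpow hu.le, ← Real.rpow_neg hu.le, mul_left_comm, inv_mul_eq_div,
    ← Real.rpow_sub_one hu.ne'] at hprod
  refine hprod.congr fun n => ?_
  have := (hTpos (u⁻¹ * a n)).ne'
  simp only [Function.comp, mul_inv, inv_inv, ← div_eq_mul_inv]
  rw [div_mul_div_cancel₀ this, mul_div_assoc]

lemma exists_eventually_inv_mul_comp_div_le (hT : RegularlyVarying T ρ) (hTpos : ∀ x, 0 < T x)
    (hTanti : Antitone T) (hρ : ρ < 0) (hle : ∀ z > 0, h z⁻¹ ≤ C * T z)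
    (ha : Tendsto a atTop atTop) :
    ∃ K p q : ℝ, -1 < p ∧ -1 < q ∧ ∀ᶠ n in atTop, ∀ u > 0,
      u⁻¹ * h (u / a n) / T (a n) ≤ K * (u ^ p + u ^ q) := by
  obtain ⟨K, hpotter⟩ := hT.exists_eventually_apply_div_le hTpos hTanti (σ := ρ - 1)
    (τ := ρ / 2) (by linarith) (by linarith) (by linarith)
  refine ⟨|C| * K, -(ρ / 2) - 1, -(ρ - 1) - 1, by linarith, by linarith, ?_⟩
  filter_upwards [ha.eventually hpotter, ha.eventually_gt_atTop 0] with n hn han u hu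
  have hTa := hTpos (a n)
  have hTu := hTpos (a n / u)
  rw [div_le_iff₀ hTa, Real.rpow_sub_one hu.ne', Real.rpow_sub_one hu.ne']
  have hh := hle (a n / u) (by positivity)
  rw [inv_div] at hh
  calc u⁻¹ * h (u / a n)
      ≤ u⁻¹ * (|C| * (K * (u ^ (-(ρ / 2)) + u ^ (-(ρ - 1))) * T (a n))) := by
        gcongr
        calc h (u / a n) ≤ |C| * T (a n / u) := hh.trans (by gcongr; exact le_abs_self C)
          _ ≤ _ := by
            gcongr
            exact hn u hu
    _ = _ := by ring

lemma integrableOn_rpow_mul_exp_one_sub_rpow {p : ℝ} (hp : -1 < p) :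
    IntegrableOn (fun u : ℝ => u ^ p * Real.exp ((1 - u ^ (1 / 2 : ℝ)) / 16)) (Set.Ioi 0) := by
  refine IntegrableOn.congr_fun ((integrableOn_rpow_mul_exp_neg_mul_rpow (s := p) (p := 1 / 2)
    (b := 1 / 16) (by linarith) (by norm_num) (by norm_num)).const_mul (Real.exp (1 / 16)))
    (fun u _ => ?_) measurableSet_Ioi
  rw [mul_left_comm, ← Real.exp_add]
  ring_nf

lemma integral_Ioc_inv_mul (g : ℝ → ℝ) (t₀ : ℝ) :
    ∫ t in Set.Ioc 0 t₀, t⁻¹ * g t = ∫ t in Set.Ioi 0, t⁻¹ * (Set.Iic t₀).indicator g t := by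
  rw [← Set.Ioi_inter_Iic, ← setIntegral_indicator measurableSet_Iic]
  simp_rw [Set.indicator_mul_right]

lemma exists_eventually_norm_indicator_comp_div_le (hT : RegularlyVarying T ρ)
    (hTpos : ∀ x, 0 < T x) (hTanti : Antitone T) (hρ : ρ < 0) (hf : RegularlyVarying f (-1))
    (hanti : Antitone f) (hpos : ∀ x, 0 < f x) (hh0 : ∀ t > 0, 0 ≤ h t)
    (hle : ∀ z > 0, h z⁻¹ ≤ C * T z) (hφ0 : ∀ t, 0 ≤ φ t)
    (hφ : (fun z => 1 - φ z⁻¹) ~[atTop] f) (ha : Tendsto a atTop atTop)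
    (hna : Tendsto (fun n : ℕ => n * f (a n)) atTop (𝓝 1)) :
    ∃ t₀ > 0, ∃ B : ℝ → ℝ, IntegrableOn B (Set.Ioi 0) ∧ ∀ᶠ n in atTop, ∀ u > 0,
      ‖u⁻¹ * (Set.Iic t₀).indicator (fun t => h t * φ t ^ (n - 1)) (u / a n) / T (a n)‖ ≤ B u := by
  obtain ⟨t₀, ht₀, hexp⟩ := exists_eventually_comp_div_pow_le hf hanti hpos hφ hφ0 ha hna
  obtain ⟨K, p, q, hp, hq, hpow⟩ :=
    exists_eventually_inv_mul_comp_div_le hT hTpos hTanti hρ hle ha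
  have hB : IntegrableOn (fun u => K * (u ^ p + u ^ q) * Real.exp ((1 - u ^ (1 / 2 : ℝ)) / 16))
      (Set.Ioi 0) := by
    simp_rw [mul_assoc, add_mul]
    exact ((integrableOn_rpow_mul_exp_one_sub_rpow hp).add
      (integrableOn_rpow_mul_exp_one_sub_rpow hq)).const_mul K
  refine ⟨t₀, ht₀, _, hB, ?_⟩
  filter_upwards [ha.eventually_gt_atTop 0, hexp, hpow] with n hn hexp hpow u hu
  have hTa := hTpos (a n)
  have hhu := hh0 (u / a n) (by positivity)
  have hφu := hφ0 (u / a n)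
  have hKpos : 0 ≤ K * (u ^ p + u ^ q) := le_trans (by positivity) (hpow u hu)
  by_cases hut : u / a n ≤ t₀
  · rw [Set.indicator_of_mem (Set.mem_Iic.2 hut), Real.norm_of_nonneg (by positivity), ← mul_assoc,
      mul_div_right_comm]
    gcongr
    exacts [hpow u hu, hexp u hu hut]
  · rw [Set.indicator_of_notMem (by simpa using hut), mul_zero, zero_div, norm_zero]
    positivity

lemma tendsto_inv_mul_indicator_comp_div_div (hT : RegularlyVarying T ρ) (hTpos : ∀ x, 0 < T x)
    (hf : RegularlyVarying f (-1)) (hlim : Tendsto (fun z => h z⁻¹ / T z) atTop (𝓝 G))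
    (hφ : (fun z => 1 - φ z⁻¹) ~[atTop] f) (ha : Tendsto a atTop atTop)
    (hna : Tendsto (fun n : ℕ => n * f (a n)) atTop (𝓝 1)) {t₀ u : ℝ} (ht₀ : 0 < t₀)
    (hu : 0 < u) :
    Tendsto (fun n =>
      u⁻¹ * (Set.Iic t₀).indicator (fun t => h t * φ t ^ (n - 1)) (u / a n) / T (a n))
      atTop (𝓝 (G * (Real.exp (-u) * u ^ (-ρ - 1)))) := by
  have hprod := (tendsto_inv_mul_comp_div_div hT hTpos hlim ha hu).mul
    (tendsto_comp_div_pow_exp_neg hf hφ ha hna hu)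
  rw [mul_assoc, mul_comm (u ^ _)] at hprod
  refine hprod.congr' ?_
  filter_upwards [(ha.const_div_atTop u).eventually_le_const ht₀] with n hn
  rw [Set.indicator_of_mem (Set.mem_Iic.2 hn)]
  ring

lemma exists_tendsto_integral_Ioc_inv_mul_pow_div (hT : RegularlyVarying T ρ)
    (hTpos : ∀ x, 0 < T x) (hTanti : Antitone T) (hρ : ρ < 0) (hf : RegularlyVarying f (-1))
    (hanti : Antitone f) (hpos : ∀ x, 0 < f x) (hh0 : ∀ t > 0, 0 ≤ h t)
    (hle : ∀ z > 0, h z⁻¹ ≤ C * T z) (hlim : Tendsto (fun z => h z⁻¹ / T z) atTop (𝓝 G))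
    (hφ0 : ∀ t, 0 ≤ φ t) (hφ : (fun z => 1 - φ z⁻¹) ~[atTop] f)
    (hint : ∀ m : ℕ, IntegrableOn (fun t => t⁻¹ * (h t * φ t ^ m)) (Set.Ioi 0))
    (ha : Tendsto a atTop atTop) (hna : Tendsto (fun n : ℕ => n * f (a n)) atTop (𝓝 1)) :
    ∃ t₀ > 0, Tendsto (fun n => (∫ t in Set.Ioc 0 t₀, t⁻¹ * (h t * φ t ^ (n - 1))) / T (a n)) atTop
      (𝓝 (G * Real.Gamma (-ρ))) := by
  obtain ⟨t₀, ht₀, B, hB, hbound⟩ := exists_eventually_norm_indicator_comp_div_le hT hTpos hTanti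
    hρ hf hanti hpos hh0 hle hφ0 hφ ha hna
  have hdct := tendsto_integral_filter_of_dominated_convergence B ?_
    (hbound.mono fun n hn => ae_restrict_of_forall_mem measurableSet_Ioi hn) hB
    (ae_restrict_of_forall_mem measurableSet_Ioi fun u hu =>
      tendsto_inv_mul_indicator_comp_div_div hT hTpos hf hlim hφ ha hna ht₀ hu)
  · rw [integral_const_mul, ← Real.Gamma_eq_integral (neg_pos.2 hρ)] at hdct
    refine ⟨t₀, ht₀, hdct.congr' ?_⟩
    filter_upwards [ha.eventually_gt_atTop 0] with n hn
    rw [integral_div, integral_inv_mul_comp_div _ hn, integral_Ioc_inv_mul]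
  · filter_upwards [ha.eventually_gt_atTop 0] with n hn
    refine ((integrableOn_inv_mul_comp_div ?_ hn).div_const _).aestronglyMeasurable
    simp_rw [← Set.indicator_mul_right]
    exact (hint (n - 1)).indicator measurableSet_Iic

lemma isBigO_sqrt_natCast (hf : RegularlyVarying f (-1)) (hanti : Antitone f)
    (hpos : ∀ x, 0 < f x) (ha : Tendsto a atTop atTop)
    (hna : Tendsto (fun n : ℕ => n * f (a n)) atTop (𝓝 1)) :
    (fun n => √(a n)) =O[atTop] fun n : ℕ => (n : ℝ) := by
  have hfa := (hf.isBigO_rpow hpos hanti (σ := -(1 / 2)) (by norm_num)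
    (by norm_num)).comp_tendsto ha
  have hone : (fun _ : ℕ => (1 : ℝ)) =O[atTop] fun n : ℕ => (n : ℝ) * f (a n) :=
    isBigO_const_left_iff_pos_le_norm one_ne_zero |>.2 ⟨1 / 2, one_half_pos, by
      filter_upwards [hna.eventually_const_le one_half_lt_one] with n hn
      exact hn.trans (le_abs_self _)⟩
  refine ((hone.trans ((isBigO_refl _ _).mul hfa)).mul (isBigO_refl (fun n => √(a n)) _)).congr'
    (.of_forall fun n => one_mul _) ?_
  filter_upwards [ha.eventually_gt_atTop 0] with n hn
  have := Real.sqrt_pos.2 hn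
  rw [Function.comp, Real.rpow_neg hn.le, ← Real.sqrt_eq_rpow, mul_assoc, inv_mul_cancel₀ this.ne',
    mul_one]

lemma tendsto_pow_div_comp (hT : RegularlyVarying T ρ) (hTpos : ∀ x, 0 < T x)
    (hTanti : Antitone T) (ha : Tendsto a atTop atTop)
    (hsqrt : (fun n => √(a n)) =O[atTop] fun n : ℕ => (n : ℝ)) {r : ℝ} (hr0 : 0 < r)
    (hr : r < 1) : Tendsto (fun n => r ^ (n - 1) / T (a n)) atTop (𝓝 0) := by
  obtain ⟨k, hk⟩ := exists_nat_gt (-ρ)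
  have hinv : (fun n => (T (a n))⁻¹) =O[atTop] fun n : ℕ => (n : ℝ) ^ (2 * k) := by
    have hTa := ((hT.rpow_isBigO hTpos hTanti (σ := -k) (by linarith) (by simp)).comp_tendsto
      ha).inv_rev ?_
    · refine (hTa.congr' .rfl ?_).trans (hsqrt.pow (2 * k))
      filter_upwards [ha.eventually_ge_atTop 0] with n hn
      rw [Function.comp, Real.rpow_neg hn, inv_inv, Real.rpow_natCast, pow_mul, Real.sq_sqrt hn]
    · filter_upwards [ha.eventually_gt_atTop 0] with n hn h0
      exact absurd h0 (Real.rpow_pos_of_pos hn _).ne'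
  have hlim := (tendsto_pow_const_mul_const_pow_of_abs_lt_one (2 * k)
    (abs_lt.2 ⟨by linarith, hr⟩)).mul_const r⁻¹
  rw [zero_mul] at hlim
  refine (((isBigO_refl (fun n => r ^ (n - 1)) atTop).mul hinv).trans_eventuallyEq
    ?_).trans_tendsto hlim
  filter_upwards [eventually_ge_atTop 1] with n hn
  rw [pow_sub₀ r hr0.ne' hn, pow_one]
  ring

lemma integral_Ioi_inv_mul_pow_le (hh0 : ∀ t > 0, 0 ≤ h t) (hφ0 : ∀ t, 0 ≤ φ t)
    (hint : ∀ m : ℕ, IntegrableOn (fun t => t⁻¹ * (h t * φ t ^ m)) (Set.Ioi 0)) {t₀ r : ℝ}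
    (ht₀ : 0 ≤ t₀) (hφr : ∀ t > t₀, φ t ≤ r) (m : ℕ) :
    ∫ t in Set.Ioi t₀, t⁻¹ * (h t * φ t ^ m) ≤ (∫ t in Set.Ioi t₀, t⁻¹ * h t) * r ^ m := by
  have hsub := Set.Ioi_subset_Ioi ht₀
  have hint0 := hint 0
  simp only [pow_zero, mul_one] at hint0
  rw [← integral_mul_const]
  refine setIntegral_mono_on ((hint m).mono_set hsub) ((hint0.mono_set hsub).mul_const _)
    measurableSet_Ioi fun t ht => ?_
  have ht0 : 0 < t := ht₀.trans_lt ht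
  have := hh0 t ht0
  rw [mul_assoc]
  gcongr
  exacts [hφ0 t, hφr t ht]

lemma tendsto_integral_Ioi_inv_mul_pow_div (hT : RegularlyVarying T ρ)
    (hTpos : ∀ x, 0 < T x) (hTanti : Antitone T) (hpos : ∀ x, 0 < f x) (hh0 : ∀ t > 0, 0 ≤ h t)
    (hφ0 : ∀ t, 0 ≤ φ t) (hφanti : AntitoneOn φ (Set.Ioi 0))
    (hφ : (fun z => 1 - φ z⁻¹) ~[atTop] f)
    (hint : ∀ m : ℕ, IntegrableOn (fun t => t⁻¹ * (h t * φ t ^ m)) (Set.Ioi 0))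
    (ha : Tendsto a atTop atTop) (hsqrt : (fun n => √(a n)) =O[atTop] fun n : ℕ => (n : ℝ))
    {t₀ : ℝ} (ht₀ : 0 < t₀) :
    Tendsto (fun n => (∫ t in Set.Ioi t₀, t⁻¹ * (h t * φ t ^ (n - 1))) / T (a n)) atTop (𝓝 0) := by
  obtain ⟨z, hz, hzt, hφz⟩ : ∃ z > 0, z⁻¹ ≤ t₀ ∧ φ z⁻¹ < 1 := by
    have hhalf := hφ.isLittleO.def one_half_pos
    obtain ⟨z, hz0, hzt, hz⟩ := ((eventually_gt_atTop 0).and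
      ((eventually_ge_atTop t₀⁻¹).and hhalf)).exists
    rw [Real.norm_of_nonneg (hpos z).le] at hz
    exact ⟨z, hz0, inv_le_of_inv_le₀ ht₀ hzt, by
      linarith [neg_le_of_abs_le hz, hpos z, Pi.sub_apply (fun z => 1 - φ z⁻¹) f z]⟩
  obtain ⟨r, hφr, hr⟩ := exists_between hφz
  have hr0 : 0 < r := (hφ0 _).trans_lt hφr
  have hlim := (tendsto_pow_div_comp hT hTpos hTanti ha hsqrt hr0 hr).const_mul
    (∫ t in Set.Ioi t₀, t⁻¹ * h t)
  rw [mul_zero] at hlim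
  refine squeeze_zero (fun n => div_nonneg (setIntegral_nonneg measurableSet_Ioi fun t ht => ?_)
    (hTpos _).le) (fun n => ?_) hlim
  · have ht0 : 0 < t := ht₀.trans ht
    have := hh0 t ht0
    have := hφ0 t
    positivity
  · rw [← mul_div_assoc]
    have := hTpos (a n)
    gcongr
    exact integral_Ioi_inv_mul_pow_le hh0 hφ0 hint ht₀.le (fun t ht =>
      (hφanti (inv_pos.2 hz) (ht₀.trans ht) (hzt.trans ht.le)).trans hφr.le) _

/-- Substituting `t = u / a n`, the power of `φ` tends to `exp (-u)` and `h (u / a n) / T (a n)` to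
`G * u ^ (-ρ)`; away from `0` the power of `φ` is geometrically small. -/
lemma tendsto_integral_inv_mul_pow_div (hT : RegularlyVarying T ρ)
    (hTpos : ∀ x, 0 < T x) (hTanti : Antitone T) (hρ : ρ < 0) (hf : RegularlyVarying f (-1))
    (hanti : Antitone f) (hpos : ∀ x, 0 < f x) (hh0 : ∀ t > 0, 0 ≤ h t)
    (hle : ∀ z > 0, h z⁻¹ ≤ C * T z) (hlim : Tendsto (fun z => h z⁻¹ / T z) atTop (𝓝 G))
    (hφ0 : ∀ t, 0 ≤ φ t) (hφanti : AntitoneOn φ (Set.Ioi 0))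
    (hφ : (fun z => 1 - φ z⁻¹) ~[atTop] f)
    (hint : ∀ m : ℕ, IntegrableOn (fun t => t⁻¹ * (h t * φ t ^ m)) (Set.Ioi 0))
    (ha : Tendsto a atTop atTop) (hna : Tendsto (fun n : ℕ => n * f (a n)) atTop (𝓝 1)) :
    Tendsto (fun n => (∫ t in Set.Ioi 0, t⁻¹ * (h t * φ t ^ (n - 1))) / T (a n)) atTop
      (𝓝 (G * Real.Gamma (-ρ))) := by
  obtain ⟨t₀, ht₀, hmain⟩ := exists_tendsto_integral_Ioc_inv_mul_pow_div hT hTpos hTanti hρ hf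
    hanti hpos hh0 hle hlim hφ0 hφ hint ha hna
  have hrem := tendsto_integral_Ioi_inv_mul_pow_div hT hTpos hTanti hpos hh0 hφ0 hφanti hφ hint ha
    (isBigO_sqrt_natCast hf hanti hpos ha hna) ht₀
  have hsum := hmain.add hrem
  rw [add_zero] at hsum
  refine hsum.congr fun n => ?_
  rw [← add_div, ← setIntegral_union (Set.Ioc_disjoint_Ioi le_rfl) measurableSet_Ioi
    ((hint _).mono_set Set.Ioc_subset_Ioi_self) ((hint _).mono_set (Set.Ioi_subset_Ioi ht₀.le)),
    Set.Ioc_union_Ioi_eq_Ioi ht₀.le]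

end LaplaceMethod

section SelfNormalizedSum

variable {Ω : Type*} [MeasurableSpace Ω] {μ : Measure Ω} [IsProbabilityMeasure μ]
  {X : ℕ → Ω → ℝ} {a : ℕ → ℝ} {γ : ℝ}

lemma tendsto_integral_gammaMean_mul_mgf_pow_div (hX : ∀ i, Measurable (X i))
    (hX0 : ∀ i ω, 0 ≤ X i ω) (hindep : iIndepFun X μ)
    (hident : ∀ i, IdentDistrib (X i) (X 0) μ μ) (hRV : RegularlyVarying (tailProb μ (X 0)) (-1))
    (ha : Tendsto a atTop atTop)
    (hna : Tendsto (fun n : ℕ => n * runningMean (tailProb μ (X 0)) (a n)) atTop (𝓝 1))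
    (hγ : 1 < γ) :
    Tendsto (fun n => (∫ t in Set.Ioi 0,
        t⁻¹ * (gammaMean μ (X 0) γ t * mgf (X 0) μ (-t) ^ (n - 1))) / tailProb μ (X 0) (a n))
      atTop (𝓝 (Real.Gamma (γ - 1))) := by
  have hpos := hRV.pos antitone_tailProb fun _ => measureReal_nonneg
  obtain ⟨C, hC⟩ := hRV.exists_gammaMean_inv_le (hX 0) (hX0 0) (one_pos.trans hγ) (neg_lt_neg hγ)
  have hlim := hRV.tendsto_gammaMean_inv_div (hX 0) (hX0 0) (one_pos.trans hγ) (neg_lt_neg hγ)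
  have hint : ∀ m : ℕ, IntegrableOn
      (fun t => t⁻¹ * (gammaMean μ (X 0) γ t * mgf (X 0) μ (-t) ^ m)) (Set.Ioi 0) := fun m => by
    simpa only [Finset.card_range, Nat.succ_sub_one] using
      integrableOn_gammaMean_mul_mgf_pow hX hX0 hindep hident
        (Finset.mem_range.2 m.succ_pos) (one_pos.trans hγ)
  simpa only [neg_neg, one_mul, Real.Gamma_one, mul_one, ← sub_eq_add_neg] using
    tendsto_integral_inv_mul_pow_div hRV hpos antitone_tailProb neg_one_lt_zero
      (hRV.runningMean antitone_tailProb hpos) (antitone_runningMean antitone_tailProb)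
      (runningMean_pos antitone_tailProb hpos) (fun t ht => gammaMean_nonneg (hX0 0) ht.le) hC
      hlim (fun _ => mgf_nonneg) ((antitoneOn_mgf_neg (hX 0) (hX0 0)).mono Set.Ioi_subset_Ici_self)
      (hRV.one_sub_mgf_neg_inv_isEquivalent (hX 0) (hX0 0)) hint ha hna

lemma tendsto_integral_div_sum_rpow_div_tailProb (hX : ∀ i, Measurable (X i))
    (hX0 : ∀ i ω, 0 ≤ X i ω) (hindep : iIndepFun X μ)
    (hident : ∀ i, IdentDistrib (X i) (X 0) μ μ) (hRV : RegularlyVarying (tailProb μ (X 0)) (-1))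
    (ha : Tendsto a atTop atTop)
    (hna : Tendsto (fun n : ℕ => n * runningMean (tailProb μ (X 0)) (a n)) atTop (𝓝 1))
    (hγ : 1 < γ) :
    Tendsto (fun n => (∫ ω, (X 0 ω / ∑ k ∈ Finset.range n, X k ω) ^ γ ∂μ) /
      tailProb μ (X 0) (a n)) atTop (𝓝 (1 / (γ - 1))) := by
  have hΓ := Real.Gamma_pos_of_pos (sub_pos.2 hγ)
  have hΓγ : Real.Gamma γ = (γ - 1) * Real.Gamma (γ - 1) := by
    simpa only [sub_add_cancel] using Real.Gamma_add_one (sub_pos.2 hγ).ne'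
  have hlim := (tendsto_integral_gammaMean_mul_mgf_pow_div hX hX0 hindep hident hRV ha hna
    hγ).div_const (Real.Gamma γ)
  rw [hΓγ, div_mul_cancel_right₀ hΓ.ne', ← one_div, ← hΓγ] at hlim
  refine hlim.congr' ?_
  filter_upwards [eventually_gt_atTop 0] with n hn
  have hrep := integral_gammaMean_mul_mgf_pow hX hX0 hindep hident (Finset.mem_range.2 hn)
    (one_pos.trans hγ)
  rw [Finset.card_range] at hrep
  rw [hrep, div_right_comm, mul_div_cancel_left₀]
  exact (Real.Gamma_pos_of_pos (one_pos.trans hγ)).ne'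

end SelfNormalizedSum

section IntegratedTail

lemma isLittleO_intervalIntegral {f g : ℝ → ℝ} {c : ℝ} (hfg : f =o[atTop] g)
    (hf : ∀ x, c ≤ x → IntervalIntegrable f volume c x)
    (hg : ∀ x, c ≤ x → IntervalIntegrable g volume c x) (hg0 : ∀ᶠ x in atTop, 0 ≤ g x)
    (hlim : Tendsto (fun x => ∫ t in c..x, g t) atTop atTop) :
    (fun x => ∫ t in c..x, f t) =o[atTop] fun x => ∫ t in c..x, g t := by
  refine IsLittleO.of_bound fun ε hε => ?_
  obtain ⟨x₀, hx₀⟩ := ((eventually_ge_atTop c).and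
    ((hfg.def (half_pos hε)).and hg0)).exists_forall_of_atTop
  have hc := (hx₀ x₀ le_rfl).1
  have hbound : ∀ x ≥ x₀, |∫ t in c..x, f t| ≤
      |∫ t in c..x₀, f t| + ε / 2 * ((∫ t in c..x, g t) - ∫ t in c..x₀, g t) := fun x hx => by
    have hcx := hc.trans hx
    have hincr : |∫ t in x₀..x, f t| ≤ ∫ t in x₀..x, ε / 2 * g t :=
      intervalIntegral.norm_integral_le_of_norm_le hx (.of_forall fun t ht => by
        simpa only [Real.norm_of_nonneg (hx₀ t ht.1.le).2.2] using (hx₀ t ht.1.le).2.1)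
        (((hg x₀ hc).symm.trans (hg x hcx)).const_mul _)
    rw [intervalIntegral.integral_interval_sub_left (hg x hcx) (hg x₀ hc),
      ← intervalIntegral.integral_const_mul,
      ← intervalIntegral.integral_add_adjacent_intervals (hf x₀ hc)
        ((hf x₀ hc).symm.trans (hf x hcx))]
    linarith [abs_add_le (∫ t in c..x₀, f t) (∫ t in x₀..x, f t)]
  filter_upwards [eventually_ge_atTop x₀, hlim.eventually_ge_atTop 0, hlim.eventually_ge_atTop
    ((|∫ t in c..x₀, f t| - ε / 2 * ∫ t in c..x₀, g t) / (ε / 2))] with x hx hx0 hlarge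
  rw [Real.norm_eq_abs, Real.norm_of_nonneg hx0]
  rw [div_le_iff₀ (half_pos hε)] at hlarge
  linarith [hbound x hx]

lemma isEquivalent_intervalIntegral {f g : ℝ → ℝ} {b c : ℝ} (hfg : f ~[atTop] g)
    (hf : ∀ x, c ≤ x → IntervalIntegrable f volume c x)
    (hg : ∀ x, IntervalIntegrable g volume b x) (hg0 : ∀ᶠ x in atTop, 0 ≤ g x)
    (hlim : Tendsto (fun x => ∫ t in b..x, g t) atTop atTop) :
    (fun x => ∫ t in c..x, f t) ~[atTop] fun x => ∫ t in b..x, g t := by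
  have hgc : ∀ x, IntervalIntegrable g volume c x := fun x => (hg c).symm.trans (hg x)
  have hsplit : ∀ x, ∫ t in c..x, g t = (∫ t in b..x, g t) - ∫ t in b..c, g t := fun x =>
    (intervalIntegral.integral_interval_sub_left (hg x) (hg c)).symm
  have hlimc : Tendsto (fun x => ∫ t in c..x, g t) atTop atTop := by
    simp_rw [hsplit, sub_eq_add_neg]
    exact tendsto_atTop_add_const_right _ _ hlim
  have hbase : (fun x => ∫ t in c..x, g t) ~[atTop] fun x => ∫ t in b..x, g t := by
    simp_rw [hsplit]
    exact IsEquivalent.refl.sub_isLittleO (isLittleO_const_left.2 (.inr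
      (tendsto_norm_atTop_atTop.comp hlim)))
  refine IsEquivalent.trans ?_ hbase
  refine (isLittleO_intervalIntegral hfg.isLittleO (fun x hx => (hf x hx).sub (hgc x))
    (fun x _ => hgc x) hg0 hlimc).congr' ?_ .rfl
  filter_upwards [eventually_ge_atTop c] with x hx
  exact intervalIntegral.integral_sub (hf x hx) (hgc x)

lemma tendsto_intervalIntegral_atTop_of_not_integrableOn {g : ℝ → ℝ} {a : ℝ}
    (hg0 : ∀ x, 0 ≤ g x) (hint : ∀ x, IntervalIntegrable g volume a x)
    (hnot : ¬ IntegrableOn g (Set.Ioi a)) :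
    Tendsto (fun x => ∫ t in a..x, g t) atTop atTop := by
  have hmono : Monotone fun x => ∫ t in a..x, g t := fun y z hyz => by
    rw [← sub_nonneg, intervalIntegral.integral_interval_sub_left (hint z) (hint y)]
    exact intervalIntegral.integral_nonneg hyz fun t _ => hg0 t
  refine tendsto_atTop_atTop_of_monotone hmono fun b => ?_
  by_contra! hlt
  refine hnot (integrableOn_Ioi_of_intervalIntegral_norm_bounded b a (fun x => (hint x).1)
    tendsto_id (.of_forall fun x => ?_))
  simpa only [Real.norm_of_nonneg (hg0 _)] using (hlt x).le

lemma tendsto_integral_tailProb_atTop {Ω : Type*} [MeasurableSpace Ω] {μ : Measure Ω}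
    [IsFiniteMeasure μ] {X : Ω → ℝ} (hX : Measurable X) (hX0 : ∀ ω, 0 ≤ X ω)
    (hinf : ∫⁻ ω, ENNReal.ofReal (X ω) ∂μ = ⊤) :
    Tendsto (fun x => ∫ t in (0 : ℝ)..x, tailProb μ X t) atTop atTop := by
  refine tendsto_intervalIntegral_atTop_of_not_integrableOn (fun _ => measureReal_nonneg)
    (fun _ => antitone_tailProb.intervalIntegrable) fun hint => hint.lintegral_lt_top.ne ?_
  rw [← hinf, lintegral_eq_lintegral_meas_lt μ (.of_forall hX0) hX.aemeasurable]
  exact lintegral_congr fun t => ofReal_measureReal (measure_ne_top _ _)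

end IntegratedTail

section NormingSequence

variable {ℓ T L : ℝ → ℝ} {a : ℕ → ℝ}

lemma SlowlyVarying.exists_admissibleLowerLimit (hℓ : SlowlyVarying ℓ)
    (hbdd : (fun x => ℓ x / x) =O[atTop] fun _ => (1 : ℝ)) : ∃ c, AdmissibleLowerLimit ℓ c := by
  obtain ⟨X, -, hmeas⟩ := hℓ.1
  obtain ⟨C, hC⟩ := hbdd.bound
  obtain ⟨c, hc⟩ := ((eventually_ge_atTop 0).and
    ((eventually_ge_atTop X).and hC)).exists_forall_of_atTop
  refine ⟨c, (hc c le_rfl).1, fun x hx => ?_⟩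
  have hℓmeas : AEMeasurable ℓ (volume.restrict (Set.Ioc c x)) :=
    ((aemeasurable_restrict_iff_comap_subtype measurableSet_Ici).2 hmeas.aemeasurable).mono_set
      fun t ht => (hc t ht.1.le).2.1
  rw [intervalIntegrable_iff_integrableOn_Ioc_of_le hx]
  refine Integrable.mono' (g := fun _ => C) (integrable_const C)
    (hℓmeas.div aemeasurable_id).aestronglyMeasurable
    (ae_restrict_of_forall_mem measurableSet_Ioc fun t ht => ?_)
  simpa only [norm_one, mul_one] using (hc t ht.1.le).2.2

lemma isNormingSequence_iff (hL : L ~[atTop] fun x => ∫ t in (0 : ℝ)..x, T t) :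
    IsNormingSequence L a ↔ Tendsto a atTop atTop ∧
      Tendsto (fun n : ℕ => n * runningMean T (a n)) atTop (𝓝 1) := by
  refine and_congr_right fun ha => ?_
  have hnL : (fun n : ℕ => (n : ℝ) * L (a n)) ~[atTop]
      fun n : ℕ => (n : ℝ) * (a n * runningMean T (a n)) := by
    simp_rw [mul_runningMean]
    exact IsEquivalent.refl.mul (hL.comp_tendsto ha)
  have hne := ha.eventually_ne_atTop 0
  calc (a ~[atTop] fun n : ℕ => (n : ℝ) * L (a n))
      ↔ (fun n : ℕ => (n : ℝ) * (a n * runningMean T (a n))) ~[atTop] a :=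
        ⟨fun h => (h.trans hnL).symm, fun h => (hnL.trans h).symm⟩
    _ ↔ _ := by
        rw [isEquivalent_iff_tendsto_one hne]
        refine tendsto_congr' ?_
        filter_upwards [hne] with n hn
        rw [Pi.div_apply, mul_left_comm, mul_div_cancel_left₀ _ hn]

lemma IsNormingSequence.natCast_mul_comp_isEquivalent (ha : IsNormingSequence L a)
    (hT : T ~[atTop] fun x => ℓ x * x⁻¹) :
    (fun n : ℕ => n * T (a n)) ~[atTop] fun n => ℓ (a n) / L (a n) := by
  refine (IsEquivalent.refl.mul ((hT.comp_tendsto ha.1).trans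
    (IsEquivalent.refl.mul ha.2.inv))).congr_right ?_
  filter_upwards [eventually_ne_atTop 0] with n hn
  have hn' : (n : ℝ) ≠ 0 := Nat.cast_ne_zero.2 hn
  simp only [Pi.mul_apply, Pi.inv_apply]
  rw [mul_inv, mul_left_comm, mul_inv_cancel_left₀ hn', div_eq_mul_inv]

end NormingSequence

lemma abs_selfNormRatio_rpow {Ω : Type*} (Y : ℕ → Ω → ℝ) (k n : ℕ) (ω : Ω) (γ : ℝ) :
    |selfNormRatio Y k n ω| ^ (2 * γ) =
      (Y k ω ^ 2 / ∑ j ∈ Finset.range n, Y j ω ^ 2) ^ γ := by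
  rw [Real.rpow_mul (abs_nonneg _), Real.rpow_two, sq_abs, selfNormRatio, selfNorm, div_pow,
    Real.sq_sqrt (Finset.sum_nonneg fun i _ => sq_nonneg _)]

theorem mainTheorem5 {Ω : Type*} [MeasurableSpace Ω] (μ : Measure Ω) [IsProbabilityMeasure μ]
    (Y : ℕ → Ω → ℝ) (hmeas : ∀ i, Measurable (Y i))
    (hindep : iIndepFun Y μ) (hident : ∀ i, IdentDistrib (Y i) (Y 0) μ μ)
    (ℓ : ℝ → ℝ) (hℓ : SlowlyVarying ℓ)
    (htail : (fun x : ℝ => μ.real {ω | x < Y 0 ω ^ 2}) ~[atTop] fun x => ℓ x * x⁻¹)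
    (hinf : ∫⁻ ω, ENNReal.ofReal (Y 0 ω ^ 2) ∂μ = ⊤) :
    (∃ c : ℝ, AdmissibleLowerLimit ℓ c) ∧
    ∀ c : ℝ, AdmissibleLowerLimit ℓ c →
      (∃ a : ℕ → ℝ, IsNormingSequence (tailIntegral ℓ c) a) ∧
      ∀ a : ℕ → ℝ, IsNormingSequence (tailIntegral ℓ c) a →
        ∀ γ : ℝ, 1 < γ →
          (fun n : ℕ => (n : ℝ) * ∫ ω, |selfNormRatio Y 0 n ω| ^ (2 * γ) ∂μ) ~[atTop]
            fun n => 1 / (γ - 1) * (ℓ (a n) / tailIntegral ℓ c (a n)) := by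
  let T := tailProb μ fun ω => Y 0 ω ^ 2
  have hTℓ : T ~[atTop] fun x => ℓ x * x⁻¹ := htail
  have hRV : RegularlyVarying T (-1) :=
    zero_add (-1 : ℝ) ▸ (hℓ.regularlyVarying.mul .inv).congr hTℓ
  have hpos := hRV.pos antitone_tailProb fun _ => measureReal_nonneg
  refine ⟨hℓ.exists_admissibleLowerLimit (hTℓ.symm.isBigO.trans isBigO_one_tailProb),
    fun c hc => ?_⟩
  have hL : tailIntegral ℓ c ~[atTop] fun x => ∫ t in (0 : ℝ)..x, T t :=
    isEquivalent_intervalIntegral hTℓ.symm hc.2 (fun _ => antitone_tailProb.intervalIntegrable)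
      (.of_forall fun x => (hpos x).le)
      (tendsto_integral_tailProb_atTop ((hmeas 0).pow_const 2) (fun _ => sq_nonneg _) hinf)
  refine ⟨?_, fun a ha γ hγ => ?_⟩
  · simp_rw [isNormingSequence_iff hL]
    exact hRV.exists_tendsto_natCast_mul_runningMean antitone_tailProb hpos
  · have hmom := tendsto_integral_div_sum_rpow_div_tailProb (X := fun i ω => Y i ω ^ 2)
      (fun i => (hmeas i).pow_const 2) (fun _ _ => sq_nonneg _)
      (hindep.comp (fun _ y => y ^ 2) fun _ => by fun_prop)
      (fun i => (hident i).comp (by fun_prop : Measurable fun y : ℝ => y ^ 2)) hRV ha.1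
      ((isNormingSequence_iff hL).1 ha).2 hγ
    refine (((isEquivalent_const_iff_tendsto (by have := sub_pos.2 hγ; positivity)).2 hmom).mul
      (ha.natCast_mul_comp_isEquivalent hTℓ)).congr_left (.of_forall fun n => ?_)
    simp only [Pi.mul_apply, abs_selfNormRatio_rpow]
    rw [mul_left_comm, div_mul_cancel₀ _ (hpos _).ne']
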